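/- Let $f$ be a $C^\infty$ function on an open set $U\subset\mathbb R^2$, let $S$ be the surface $z=f(x,y)$, and write $f_{ij}=\partial^{i+j}f/\partial x^i\partial y^j$, $H=f_{20}f_{02}-f_{11}^2$. At each point let $Q$ and $C$ be the quadratic and cubic parts of the Taylor expansion of $f$ at that point (as forms on the tangent plane), and let $W=4HC-Q\,dH$ be the fundamental cubic form. The elliptic domain is $\{H>0\}$, the hyperbolic domain is $\{H<0\}$, the parabolic curve is $\{H=0\}$; asymptotic lines are the lines of zeros of $Q$. In the elliptic domain the lines of zeros of $W$ form the field $\tau$. A godron is a parabolic point $p$ with $Q\ne0$ and $dH\neq 0$ at which the unique asymptotic line is tangent to the parabolic curve. It is called positive (resp. negative) if, at all parabolic points $x\neq p$ near $p$, the asymptotic line is transverse to the parabolic curve and its half directed to the hyperbolic domain points towards (resp. away from) $p$. The index of $\tau$ at $p$, as a boundary singular point of the elliptic domain, is defined as follows. For a small disk centred at $p$, let $\gamma$ be the part of its boundary circle lying in $\{H\ge0\}$: an arc traversed in the positive sense around $p$, from $A$ to $B$, with $A,B$ on the parabolic curve. Along $\gamma$ the field $\tau$ consists of three continuous branches, pairwise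 distinct except at the endpoints, where two of the lines coincide and the third is tangent to the parabolic curve. Modify these branches by an arbitrarily small amount so that the three lines are pairwise distinct on all of $\gamma$ and one of them is tangent to the parabolic curve at $A$ and at $B$. Identify the directions at $B$ with the directions at $A$ by an orientation-preserving homeomorphism that sends lines to lines, the oriented tangent of the boundary at $B$ to that at $A$ (oriented continuously along the boundary inside the disk), and the three lines at $B$ to the three lines at $A$. The index is the rational number $m/q$ such that each oriented line of the field, followed along the closed path $\gamma/(A\sim B)$, comes back after $q$ turns of the path to its initial position with the same orientation, having made $m$ turns. Then for every godron $p$ of $S$ this index is well defined when $p$ is positive or negative (for every sufficiently small disk, arbitrarily small modifications as above exist, and for every sufficiently small one the identification exists and the index does not depend on the choices), and $$\mathrm{ind}_{p}(\tau)=-\tfrac13\ \text{ if $p$ is positive},\qquad \mathrm{ind}_{p}(\tau)=\tfrac13\ \text{ if $p$ is negative}.$$ -/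

import Mathlib

open Set Filter Topology
open scoped ContDiff LinearAlgebra.Projectivization

noncomputable section

/-! ### Second fundamental form, Hessian and fundamental cubic form of a graph `z = f (x, y)` -/

/-- The partial derivative `f_{ij} = ∂^{i+j} f / ∂x^i ∂y^j` of a function of two variables. -/
def pd (i j : ℕ) (f : ℝ × ℝ → ℝ) : ℝ × ℝ → ℝ :=
  (fun g x => fderiv ℝ g x (1, 0))^[i] ((fun g x => fderiv ℝ g x (0, 1))^[j] f)

/-- The second fundamental form `Q` at the point `x`: the quadratic part of the Taylor expansion
of `f` at `x`, evaluated on the vector `v`. -/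
def secondForm (f : ℝ × ℝ → ℝ) (x v : ℝ × ℝ) : ℝ :=
  (1 / 2) * (pd 2 0 f x * v.1 ^ 2 + 2 * pd 1 1 f x * v.1 * v.2 + pd 0 2 f x * v.2 ^ 2)

/-- The cubic part `C` of the Taylor expansion of `f` at `x`, evaluated on the vector `v`. -/
def cubicPart (f : ℝ × ℝ → ℝ) (x v : ℝ × ℝ) : ℝ :=
  (1 / 6) * (pd 3 0 f x * v.1 ^ 3 + 3 * pd 2 1 f x * v.1 ^ 2 * v.2
    + 3 * pd 1 2 f x * v.1 * v.2 ^ 2 + pd 0 3 f x * v.2 ^ 3)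

/-- The Hessian `H = f₂₀ f₀₂ - f₁₁²`: positive at the elliptic points, negative at the hyperbolic
points, zero at the parabolic points. -/
def hessian (f : ℝ × ℝ → ℝ) (x : ℝ × ℝ) : ℝ :=
  pd 2 0 f x * pd 0 2 f x - pd 1 1 f x ^ 2

/-- The fundamental cubic form `W = 4 H C - Q dH` at the point `x`. -/
def cubicForm (f : ℝ × ℝ → ℝ) (x v : ℝ × ℝ) : ℝ :=
  4 * hessian f x * cubicPart f x v - secondForm f x v * fderiv ℝ (hessian f) x v

/-- The field `τ` of lines of zeros of the fundamental cubic form. -/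
def zeroLines (f : ℝ × ℝ → ℝ) (x : ℝ × ℝ) : Set (ℙ ℝ (ℝ × ℝ)) :=
  {l | ∀ v ∈ l.submodule, cubicForm f x v = 0}

/-! ### Godrons -/

/-- `x` is a godron: a parabolic point with a unique asymptotic line, at which the parabolic
curve is smooth and tangent to the asymptotic line. -/
def IsGodron (f : ℝ × ℝ → ℝ) (x : ℝ × ℝ) : Prop :=
  hessian f x = 0 ∧ (∃ v, secondForm f x v ≠ 0) ∧ (∃ v, fderiv ℝ (hessian f) x v ≠ 0) ∧
    ∀ v, secondForm f x v = 0 → fderiv ℝ (hessian f) x v = 0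

/-- A godron `p` is positive if at the neighbouring parabolic points `x` the asymptotic line is
transverse to the parabolic curve, and its half directed to the hyperbolic domain (spanned by an
asymptotic vector `v` with `dH v < 0`) points towards `p`. -/
def IsPositiveGodron (f : ℝ × ℝ → ℝ) (p : ℝ × ℝ) : Prop :=
  IsGodron f p ∧ ∀ᶠ x in 𝓝[≠] p, hessian f x = 0 → ∀ v : ℝ × ℝ, v ≠ 0 → secondForm f x v = 0 →
    fderiv ℝ (hessian f) x v ≠ 0 ∧
    (fderiv ℝ (hessian f) x v < 0 → 0 < v.1 * (p.1 - x.1) + v.2 * (p.2 - x.2))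

/-- A godron `p` is negative if at the neighbouring parabolic points the half-asymptotic lines
directed to the hyperbolic domain point away from `p`. -/
def IsNegativeGodron (f : ℝ × ℝ → ℝ) (p : ℝ × ℝ) : Prop :=
  IsGodron f p ∧ ∀ᶠ x in 𝓝[≠] p, hessian f x = 0 → ∀ v : ℝ × ℝ, v ≠ 0 → secondForm f x v = 0 →
    fderiv ℝ (hessian f) x v ≠ 0 ∧
    (fderiv ℝ (hessian f) x v < 0 → v.1 * (p.1 - x.1) + v.2 * (p.2 - x.2) < 0)

/-! ### Multivalued line fields near a boundary point, and their fractional index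

The surface with boundary is given, near the boundary point `p`, as `{x | 0 ≤ G x}` with
`dG ≠ 0`. A line is described by an angle, defined up to multiples of `π`; an oriented line by an
angle up to multiples of `2π`. -/

theorem cos_sin_ne_zero (t : ℝ) : ((Real.cos t, Real.sin t) : ℝ × ℝ) ≠ 0 := by
  intro h
  have h1 : Real.cos t = 0 := congrArg Prod.fst h
  have h2 : Real.sin t = 0 := congrArg Prod.snd h
  have h3 := Real.sin_sq_add_cos_sq t
  rw [h1, h2] at h3
  norm_num at h3

/-- The line through the origin with direction `(cos t, sin t)`. -/
def lineOfAngle (t : ℝ) : ℙ ℝ (ℝ × ℝ) :=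
  Projectivization.mk ℝ (Real.cos t, Real.sin t) (cos_sin_ne_zero t)

/-- The point with polar angle `φ` on the circle of centre `p` and radius `r`. -/
def circlePoint (p : ℝ × ℝ) (r φ : ℝ) : ℝ × ℝ :=
  (p.1 + r * Real.cos φ, p.2 + r * Real.sin φ)

/-- The part `γ` of the circle of centre `p` and radius `r` lying in the surface `{0 ≤ G}` is the
arc `a ≤ φ ≤ b`; it lies in the interior of the surface except for its endpoints, `A` (at
`φ = a`) and `B` (at `φ = b`), which are on the boundary. It is traversed in the positive sense
around `p`. -/
structure IsBorderArc (G : ℝ × ℝ → ℝ) (p : ℝ × ℝ) (r a b : ℝ) : Prop where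
  lt : a < b
  lt_add : b < a + 2 * Real.pi
  start : G (circlePoint p r a) = 0
  finish : G (circlePoint p r b) = 0
  inside : ∀ φ ∈ Ioo a b, 0 < G (circlePoint p r φ)
  outside : ∀ φ ∈ Ioo b (a + 2 * Real.pi), G (circlePoint p r φ) < 0

/-- `β` is a continuous determination, on the disk of centre `p` and radius `r`, of the angle of
the level curves of `G`, oriented so that `G` increases to their left. On `{G = 0}` it is the
angle of the boundary of the surface, oriented and cooriented by the surface. -/
structure IsBoundaryAngle (G : ℝ × ℝ → ℝ) (p : ℝ × ℝ) (r : ℝ) (β : ℝ × ℝ → ℝ) : Prop where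
  cont : ContinuousOn β {x | (x.1 - p.1) ^ 2 + (x.2 - p.2) ^ 2 ≤ r ^ 2}
  angle : ∀ x : ℝ × ℝ, (x.1 - p.1) ^ 2 + (x.2 - p.2) ^ 2 ≤ r ^ 2 → ∃ c : ℝ, 0 < c ∧
    fderiv ℝ G x (1, 0) = c * (-Real.sin (β x)) ∧ fderiv ℝ G x (0, 1) = c * Real.cos (β x)

/-- `θ` are the `k` continuous branches, along the arc, of the line field `τ`: its lines are
pairwise distinct at the interior points of the surface, and the branches extend continuously to
the endpoints of the arc, where some of them may coincide. -/
structure IsBranches {k : ℕ} (τ : ℝ × ℝ → Set (ℙ ℝ (ℝ × ℝ))) (p : ℝ × ℝ) (r a b : ℝ)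
    (θ : Fin k → ℝ → ℝ) : Prop where
  cont : ∀ i, ContinuousOn (θ i) (Icc a b)
  distinct : ∀ φ ∈ Ioo a b, Function.Injective fun i => lineOfAngle (θ i φ)
  lines : ∀ φ ∈ Ioo a b, τ (circlePoint p r φ) = range fun i => lineOfAngle (θ i φ)

/-- `θ'` is a modification of `θ` of size less than `ε` that satisfies the triviality condition:
the `k` lines are pairwise distinct up to the endpoints `A`, `B` included, and at `A` and at `B`
one of them is tangent to the boundary. Here `βA` and `βB` are the angles of the boundary. -/
structure IsResolution {k : ℕ} (a b βA βB : ℝ) (θ : Fin k → ℝ → ℝ) (ε : ℝ)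
    (θ' : Fin k → ℝ → ℝ) : Prop where
  cont : ∀ i, ContinuousOn (θ' i) (Icc a b)
  close : ∀ i, ∀ φ ∈ Icc a b, |θ' i φ - θ i φ| < ε
  distinct : ∀ φ ∈ Icc a b, Function.Injective fun i => lineOfAngle (θ' i φ)
  tangent_start : ∃ i, lineOfAngle (θ' i a) = lineOfAngle βA
  tangent_finish : ∃ i, lineOfAngle (θ' i b) = lineOfAngle βB

/-- `h` is an identification of the tangent plane at `B` with the tangent plane at `A`: an
orientation preserving homeomorphism of the circles of directions (lifted to angles) that sends
lines to lines, the oriented tangent of the boundary to the oriented tangent of the boundary, and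
the values of the field at `B` to its values at `A`. -/
structure IsGluing {k : ℕ} (a b βA βB : ℝ) (θ : Fin k → ℝ → ℝ) (h : ℝ ≃o ℝ) : Prop where
  equivariant : ∀ t, h (t + Real.pi) = h t + Real.pi
  boundary : h βB = βA
  lines : (range fun i => lineOfAngle (h (θ i b))) = range fun i => lineOfAngle (θ i a)

/-- The fractional index along the closed path `γ / (A ∼ B)`, glued by `h`: it is `m / q` if each
(oriented) line of the field, followed along the closed path, comes back after `q` turns to its
initial position with the same orientation, having made `m` turns. The oriented line followed
during the `n`-th passage along `γ` has angle `θ (i n) + s n * π`. -/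
def HasClosedPathIndex {k : ℕ} (a b : ℝ) (θ : Fin k → ℝ → ℝ) (h : ℝ ≃o ℝ) (ind : ℚ) : Prop :=
  ∃ (q : ℕ) (m : ℤ), 0 < q ∧ ind = (m : ℚ) / (q : ℚ) ∧
    ∀ (i : ℕ → Fin k) (s : ℕ → ℤ),
      (∀ n, θ (i (n + 1)) a + s (n + 1) * Real.pi = h (θ (i n) b + s n * Real.pi)) →
      θ (i q) a + s q * Real.pi = θ (i 0) a + s 0 * Real.pi + 2 * Real.pi * m

/-- All the data on the disk of radius `r` that enter the definition of the index. -/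
structure IsBorderSetup {k : ℕ} (G : ℝ × ℝ → ℝ) (τ : ℝ × ℝ → Set (ℙ ℝ (ℝ × ℝ))) (p : ℝ × ℝ)
    (r a b : ℝ) (β : ℝ × ℝ → ℝ) (θ : Fin k → ℝ → ℝ) : Prop where
  arc : IsBorderArc G p r a b
  angle : IsBoundaryAngle G p r β
  branches : IsBranches τ p r a b θ

/-- The `k`-valued line field `τ` on the surface `{0 ≤ G}` has fractional index `ind` at the
boundary point `p`, one of its branches being tangent to the boundary at the boundary points near
`p` while other branches may coincide there: on every sufficiently small disk, the field along
`γ` can be resolved by an arbitrarily small modification, and every sufficiently small resolution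
has index `ind` along the closed path `γ / (A ∼ B)`. -/
def HasBorderIndex (k : ℕ) (G : ℝ × ℝ → ℝ) (τ : ℝ × ℝ → Set (ℙ ℝ (ℝ × ℝ))) (p : ℝ × ℝ)
    (ind : ℚ) : Prop :=
  ∃ R : ℝ, 0 < R ∧ ∀ r : ℝ, 0 < r → r < R →
    (∃ (a b : ℝ) (β : ℝ × ℝ → ℝ) (θ : Fin k → ℝ → ℝ), IsBorderSetup G τ p r a b β θ) ∧
    ∀ (a b : ℝ) (β : ℝ × ℝ → ℝ) (θ : Fin k → ℝ → ℝ), IsBorderSetup G τ p r a b β θ →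
      (∀ ε : ℝ, 0 < ε → ∃ θ' : Fin k → ℝ → ℝ,
        IsResolution a b (β (circlePoint p r a)) (β (circlePoint p r b)) θ ε θ') ∧
      ∃ ε : ℝ, 0 < ε ∧ ∀ θ' : Fin k → ℝ → ℝ,
        IsResolution a b (β (circlePoint p r a)) (β (circlePoint p r b)) θ ε θ' →
        (∃ h : ℝ ≃o ℝ,
          IsGluing a b (β (circlePoint p r a)) (β (circlePoint p r b)) θ' h) ∧
        ∀ h : ℝ ≃o ℝ,
          IsGluing a b (β (circlePoint p r a)) (β (circlePoint p r b)) θ' h →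
          HasClosedPathIndex a b θ' h ind

end

/-! Near `p`, use the fixed orthonormal frame whose first vector is tangent to the parabolic curve
at `p` and whose second vector points into the elliptic domain. The form W is apolar to Q
(`apolar`). Consequently, for the monic cubic in the slope `u`, with `c` and `b` the coefficients of
`3u²` and `3u`, set η = H/G² and P = c² - b. Then P = (c - F/G)² + η, and the discriminant is a
positive multiple of ηP² (`discr_of_apolar`). Where H > 0 there are three distinct real slopes.
Where H = 0, W = -Q dH: the asymptotic slope is a double root and the slope of the parabolic curve a
simple one (`coef_of_hessian_eq_zero`).

The three slopes in increasing order therefore give continuous branches on the closed arc. At an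
endpoint the tangent to the boundary is the lowest or the highest branch, according to the sign of
`slopeGap` there. The sign of the godron decides which (`slopeGap_sign`): for a positive one the
tangent is lowest at A and highest at B, for a negative one the reverse.

The rest is combinatorial. Number the oriented lines of a sorted triple by the integers, three per
half-turn. A gluing is a shift of these numbers (`IsSorted.exists_shift`), and matching the boundary
tangents forces the shift kA - kB = ±2. Three passages shift by ±6, which is one full turn, so the
index is ±1/3. A small resolution keeps the order of the branches and the position of the tangent
(`IsOrdered.exists_sorted_of_close`, `exists_eq_tangent_of_close`). Any other choice of branches is
a renumbering of the sorted one up to half-turns (`IsOrdered.exists_eq_reindex`), which affects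
neither gluing nor index. -/

noncomputable section

/-! ### Lines and angles -/

theorem lineOfAngle_eq_iff_sin (s t : ℝ) :
    lineOfAngle s = lineOfAngle t ↔ Real.sin (s - t) = 0 := by
  unfold lineOfAngle
  rw [Projectivization.mk_eq_mk_iff']
  constructor
  · rintro ⟨a, ha⟩
    have h1 : a * Real.cos t = Real.cos s := congrArg Prod.fst ha
    have h2 : a * Real.sin t = Real.sin s := congrArg Prod.snd ha
    rw [Real.sin_sub, ← h1, ← h2]
    ring
  · intro h
    refine ⟨Real.cos (s - t), Prod.ext ?_ ?_⟩
    · have := Real.cos_add (s - t) t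
      rw [h, sub_add_cancel] at this
      simp only [Prod.smul_mk, smul_eq_mul]
      linarith
    · have := Real.sin_add (s - t) t
      rw [h, sub_add_cancel] at this
      simp only [Prod.smul_mk, smul_eq_mul]
      linarith

theorem lineOfAngle_eq_iff (s t : ℝ) :
    lineOfAngle s = lineOfAngle t ↔ ∃ n : ℤ, s = t + n * Real.pi := by
  rw [lineOfAngle_eq_iff_sin, Real.sin_eq_zero_iff]
  exact exists_congr fun n => ⟨fun h => by linarith, fun h => by linarith⟩

theorem lineOfAngle_add_int_mul_pi (t : ℝ) (n : ℤ) :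
    lineOfAngle (t + n * Real.pi) = lineOfAngle t :=
  (lineOfAngle_eq_iff _ _).2 ⟨n, rfl⟩

theorem exists_eq_lineOfAngle (l : ℙ ℝ (ℝ × ℝ)) : ∃ t, l = lineOfAngle t := by
  induction l using Projectivization.ind with
  | h v hv =>
    obtain ⟨x, y⟩ := v
    have hz : (⟨x, y⟩ : ℂ) ≠ 0 := fun h => hv (by
      rw [Complex.ext_iff] at h
      exact Prod.ext h.1 h.2)
    refine ⟨Complex.arg ⟨x, y⟩, ?_⟩
    unfold lineOfAngle
    rw [Projectivization.mk_eq_mk_iff']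
    refine ⟨‖(⟨x, y⟩ : ℂ)‖, Prod.ext ?_ ?_⟩
    · exact Complex.norm_mul_cos_arg _
    · exact Complex.norm_mul_sin_arg _

/-! ### Equivariant homeomorphisms and sheets of a triple of lines -/

theorem OrderIso.map_add_int_mul_pi {h : ℝ ≃o ℝ} (hh : ∀ t, h (t + Real.pi) = h t + Real.pi)
    (t : ℝ) (n : ℤ) : h (t + n * Real.pi) = h t + n * Real.pi := by
  induction n with
  | zero => simp
  | succ n ih =>
    have : t + ((n : ℤ) + 1 : ℤ) * Real.pi = t + (n : ℤ) * Real.pi + Real.pi := by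
      push_cast; ring
    rw [this, hh, ih]
    push_cast
    ring
  | pred n ih =>
    have h1 := hh (t + ((-(n : ℤ) - 1 : ℤ) : ℝ) * Real.pi)
    have : t + ((-(n : ℤ) - 1 : ℤ) : ℝ) * Real.pi + Real.pi
        = t + ((-(n : ℤ) : ℤ) : ℝ) * Real.pi := by
      push_cast; ring
    rw [this, ih] at h1
    push_cast at h1 ⊢
    linarith

/-- The angles of the oriented lines of a triple of lines, enumerated by the integers: the `k`-th
line turned by `n` half-turns has number `3 n + k`. -/
def sheet (u : Fin 3 → ℝ) (N : ℤ) : ℝ :=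
  u ⟨(N % 3).toNat, by omega⟩ + (N / 3 : ℤ) * Real.pi

theorem sheet_mul_add (u : Fin 3 → ℝ) (n : ℤ) (k : Fin 3) :
    sheet u (3 * n + k) = u k + n * Real.pi := by
  have hk := k.isLt
  unfold sheet
  congr 2
  · congr 1
    omega
  · congr 1
    omega

theorem exists_eq_mul_add (N : ℤ) : ∃ (n : ℤ) (k : Fin 3), N = 3 * n + k :=
  ⟨N / 3, ⟨(N % 3).toNat, by omega⟩, by
    change N = 3 * (N / 3) + ((N % 3).toNat : ℤ)
    omega⟩

theorem sheet_add_mul (u : Fin 3 → ℝ) (N m : ℤ) :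
    sheet u (N + 3 * m) = sheet u N + m * Real.pi := by
  obtain ⟨n, k, rfl⟩ := exists_eq_mul_add N
  have : 3 * n + (k : ℤ) + 3 * m = 3 * (n + m) + k := by ring
  rw [this, sheet_mul_add, sheet_mul_add]
  push_cast
  ring

/-- Three angles in increasing order, within a half-turn. -/
structure IsSorted (u : Fin 3 → ℝ) : Prop where
  lt₀₁ : u 0 < u 1
  lt₁₂ : u 1 < u 2
  lt₂₀ : u 2 < u 0 + Real.pi

/-- The wrap-around bound `lt₂₀` handles the passage from the last line of one half-turn to the
first of the next. Afterwards, angles on the sheets can be compared through integers. -/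
theorem IsSorted.strictMono {u : Fin 3 → ℝ} (hu : IsSorted u) : StrictMono (sheet u) := by
  refine strictMono_int_of_lt_succ fun N => ?_
  obtain ⟨n, k, rfl⟩ := exists_eq_mul_add N
  have h1 := hu.lt₀₁
  have h2 := hu.lt₁₂
  have h3 := hu.lt₂₀
  fin_cases k
  · have e : 3 * n + (((0 : Fin 3) : ℕ) : ℤ) + 1 = 3 * n + ((1 : Fin 3) : ℕ) := by simp
    change sheet u (3 * n + (((0 : Fin 3) : ℕ) : ℤ)) < sheet u (3 * n + (((0 : Fin 3) : ℕ) : ℤ) + 1)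
    rw [e, sheet_mul_add, sheet_mul_add]
    linarith
  · have e : 3 * n + (((1 : Fin 3) : ℕ) : ℤ) + 1 = 3 * n + ((2 : Fin 3) : ℕ) := by
      simp [add_assoc]
    change sheet u (3 * n + (((1 : Fin 3) : ℕ) : ℤ)) < sheet u (3 * n + (((1 : Fin 3) : ℕ) : ℤ) + 1)
    rw [e, sheet_mul_add, sheet_mul_add]
    linarith
  · have e : 3 * n + (((2 : Fin 3) : ℕ) : ℤ) + 1 = 3 * (n + 1) + ((0 : Fin 3) : ℕ) := by
      simp; ring
    change sheet u (3 * n + (((2 : Fin 3) : ℕ) : ℤ)) < sheet u (3 * n + (((2 : Fin 3) : ℕ) : ℤ) + 1)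
    rw [e, sheet_mul_add, sheet_mul_add]
    push_cast
    linarith

/-- The piecewise affine interpolation of the sheets. -/
def sheetInterp (u : Fin 3 → ℝ) (t : ℝ) : ℝ :=
  sheet u ⌊t⌋ + Int.fract t * (sheet u (⌊t⌋ + 1) - sheet u ⌊t⌋)

theorem sheetInterp_intCast (u : Fin 3 → ℝ) (N : ℤ) : sheetInterp u N = sheet u N := by
  simp [sheetInterp]

theorem sheetInterp_add_three (u : Fin 3 → ℝ) (t : ℝ) :
    sheetInterp u (t + 3) = sheetInterp u t + Real.pi := by
  have h3 : t + 3 = t + ((3 : ℤ) : ℝ) := by norm_num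
  have e1 := sheet_add_mul u ⌊t⌋ 1
  have e2 := sheet_add_mul u (⌊t⌋ + 1) 1
  have e3 : ⌊t⌋ + 3 + 1 = ⌊t⌋ + 1 + 3 * 1 := by ring
  have e4 : ⌊t⌋ + 3 = ⌊t⌋ + 3 * 1 := by ring
  unfold sheetInterp
  rw [h3, Int.floor_add_intCast, Int.fract_add_intCast, e3, e2, e4, e1]
  push_cast
  ring

theorem IsSorted.sheetInterp_strictMono {u : Fin 3 → ℝ} (hu : IsSorted u) :
    StrictMono (sheetInterp u) := by
  intro s t hst
  have hm := hu.strictMono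
  have gap : ∀ N : ℤ, 0 < sheet u (N + 1) - sheet u N := fun N => sub_pos.2 (hm (by omega))
  unfold sheetInterp
  rcases (Int.floor_mono hst.le).eq_or_lt with h | h
  · rw [h]
    have : Int.fract s < Int.fract t := by
      have h' : (⌊s⌋ : ℝ) = ⌊t⌋ := by rw [h]
      unfold Int.fract
      linarith
    have := mul_lt_mul_of_pos_right this (gap ⌊t⌋)
    linarith
  · have h1 : sheet u (⌊s⌋ + 1) ≤ sheet u ⌊t⌋ := hm.monotone (by omega)
    have h2 := mul_lt_mul_of_pos_right (Int.fract_lt_one s) (gap ⌊s⌋)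
    have h3 := mul_nonneg (Int.fract_nonneg t) (gap ⌊t⌋).le
    linarith

theorem IsSorted.sheetInterp_surjective {u : Fin 3 → ℝ} (hu : IsSorted u) :
    Function.Surjective (sheetInterp u) := by
  intro y
  have hm := hu.strictMono
  have hval : ∀ n : ℤ, sheet u (3 * n) = u 0 + n * Real.pi := fun n => by
    simpa using sheet_mul_add u n 0
  obtain ⟨m, hm1⟩ : ∃ m : ℤ, sheet u (3 * m) ≤ y := by
    refine ⟨⌊(y - u 0) / Real.pi⌋, ?_⟩
    rw [hval]
    have := mul_le_mul_of_nonneg_right (Int.floor_le ((y - u 0) / Real.pi)) Real.pi_pos.le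
    rw [div_mul_cancel₀ _ Real.pi_ne_zero] at this
    linarith
  obtain ⟨n, hn1⟩ : ∃ n : ℤ, y < sheet u (3 * n) := by
    refine ⟨⌊(y - u 0) / Real.pi⌋ + 1, ?_⟩
    rw [hval]
    have := mul_lt_mul_of_pos_right (Int.lt_floor_add_one ((y - u 0) / Real.pi)) Real.pi_pos
    rw [div_mul_cancel₀ _ Real.pi_ne_zero] at this
    push_cast
    linarith
  obtain ⟨N, hN, hmax⟩ := Int.exists_greatest_of_bdd (P := fun N => sheet u N ≤ y)
    ⟨3 * n, fun z hz => (hm.lt_iff_lt.1 (hz.trans_lt hn1)).le⟩ ⟨_, hm1⟩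
  have hN' : y < sheet u (N + 1) := by
    by_contra hc
    have := hmax _ (not_lt.1 hc)
    omega
  have gap : 0 < sheet u (N + 1) - sheet u N := sub_pos.2 (hm (by omega))
  set w := (y - sheet u N) / (sheet u (N + 1) - sheet u N) with hw
  have w0 : 0 ≤ w := div_nonneg (sub_nonneg.2 hN) gap.le
  have w1 : w < 1 := (div_lt_one gap).2 (by linarith)
  have hfl : ⌊(N : ℝ) + w⌋ = N := by
    rw [Int.floor_eq_iff]
    constructor <;> linarith
  refine ⟨N + w, ?_⟩
  unfold sheetInterp
  rw [hfl, Int.fract, hfl, add_sub_cancel_left, hw, div_mul_cancel₀ _ gap.ne']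
  ring

/-- The interpolation of the sheets as a homeomorphism of the line. -/
def IsSorted.orderIso {u : Fin 3 → ℝ} (hu : IsSorted u) : ℝ ≃o ℝ :=
  hu.sheetInterp_strictMono.orderIsoOfSurjective _ hu.sheetInterp_surjective

theorem IsSorted.orderIso_apply {u : Fin 3 → ℝ} (hu : IsSorted u) (t : ℝ) :
    hu.orderIso t = sheetInterp u t := rfl

/-- Two sorted triples can be matched with any prescribed shift of the sheets. -/
theorem IsSorted.exists_orderIso {u v : Fin 3 → ℝ} (hu : IsSorted u) (hv : IsSorted v) (d : ℤ) :
    ∃ h : ℝ ≃o ℝ, (∀ t, h (t + Real.pi) = h t + Real.pi) ∧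
      ∀ N, h (sheet u N) = sheet v (N + d) := by
  -- The translation by `d`, read in the interpolated sheet coordinates. A half-turn is the
  -- translation by 3 in both coordinates, so it commutes with the result.
  refine ⟨hu.orderIso.symm.trans ((OrderIso.addRight (d : ℝ)).trans hv.orderIso), fun t => ?_,
    fun N => ?_⟩
  · have : hu.orderIso.symm (t + Real.pi) = hu.orderIso.symm t + 3 := by
      rw [OrderIso.symm_apply_eq, orderIso_apply, sheetInterp_add_three, ← orderIso_apply hu,
        OrderIso.apply_symm_apply]
    simp only [OrderIso.trans_apply, this, OrderIso.addRight_apply]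
    rw [add_right_comm, orderIso_apply, orderIso_apply, sheetInterp_add_three]
  · have : hu.orderIso.symm (sheet u N) = N := by
      rw [OrderIso.symm_apply_eq, orderIso_apply, sheetInterp_intCast]
    simp only [OrderIso.trans_apply, this, OrderIso.addRight_apply]
    rw [← Int.cast_add, orderIso_apply, sheetInterp_intCast]

/-- A homeomorphism that sends the lines of a sorted triple to those of another one shifts the
sheets. -/
theorem IsSorted.exists_shift {u v : Fin 3 → ℝ} (hu : IsSorted u) (hv : IsSorted v) {h : ℝ ≃o ℝ}
    (hh : ∀ t, h (t + Real.pi) = h t + Real.pi)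
    (hl : (range fun i => lineOfAngle (h (u i))) = range fun i => lineOfAngle (v i)) :
    ∃ d : ℤ, ∀ N, h (sheet u N) = sheet v (N + d) := by
  have hmap : ∀ N, ∃ M, h (sheet u N) = sheet v M := by
    intro N
    obtain ⟨n, k, rfl⟩ := exists_eq_mul_add N
    obtain ⟨j, hj⟩ : lineOfAngle (h (u k)) ∈ range fun i => lineOfAngle (v i) :=
      hl ▸ mem_range_self k
    obtain ⟨m, hm⟩ := (lineOfAngle_eq_iff _ _).1 hj.symm
    refine ⟨3 * (m + n) + j, ?_⟩
    rw [sheet_mul_add, sheet_mul_add, OrderIso.map_add_int_mul_pi hh, hm]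
    push_cast
    ring
  have hsurj : ∀ M, ∃ N, h (sheet u N) = sheet v M := by
    intro M
    obtain ⟨n, k, rfl⟩ := exists_eq_mul_add M
    obtain ⟨j, hj⟩ : lineOfAngle (v k) ∈ range fun i => lineOfAngle (h (u i)) :=
      hl ▸ mem_range_self k
    obtain ⟨m, hm⟩ := (lineOfAngle_eq_iff _ _).1 hj.symm
    refine ⟨3 * (m + n) + j, ?_⟩
    rw [sheet_mul_add, sheet_mul_add, OrderIso.map_add_int_mul_pi hh, hm]
    push_cast
    ring
  choose g hg using hmap
  have hgm : StrictMono g := fun M N hMN => by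
    rw [← hv.strictMono.lt_iff_lt, ← hg, ← hg]
    exact h.strictMono (hu.strictMono hMN)
  -- A strictly increasing surjection of ℤ skips no integer, so it is a translation.
  have hsucc : ∀ N, g (N + 1) = g N + 1 := by
    intro N
    obtain ⟨M, hM⟩ := hsurj (g N + 1)
    rw [hg] at hM
    have hM' : g M = g N + 1 := hv.strictMono.injective hM
    have h1 : N < M := hgm.lt_iff_lt.1 (by omega)
    have h2 : g (N + 1) ≤ g M := hgm.monotone (by omega)
    have h3 : g N < g (N + 1) := hgm (by omega)
    omega
  refine ⟨g 0, fun N => ?_⟩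
  rw [hg]
  congr 1
  induction N with
  | zero => simp
  | succ n ih => rw [hsucc, ih]; ring
  | pred n ih =>
    have := hsucc (-(n : ℤ) - 1)
    rw [sub_add_cancel, ih] at this
    omega

/-! ### The index of a sorted triple of branches -/

/-- The shift by kA - kB carries the sheet of the tangent at B to that of the tangent at A. The same
`N` serves both ends, so no further half-turns enter. -/
theorem IsSorted.isGluing_exists {a b βA βB : ℝ} {u : Fin 3 → ℝ → ℝ}
    (ha : IsSorted fun i => u i a) (hb : IsSorted fun i => u i b) {kA kB : Fin 3} {N : ℤ}
    (hA : βA = u kA a + N * Real.pi) (hB : βB = u kB b + N * Real.pi) :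
    ∃ h : ℝ ≃o ℝ, IsGluing a b βA βB u h := by
  obtain ⟨h, h1, h2⟩ := hb.exists_orderIso ha ((kA : ℕ) - (kB : ℕ) : ℤ)
  refine ⟨h, h1, ?_, ?_⟩
  · have := h2 (3 * N + kB)
    rw [sheet_mul_add, ← hB] at this
    rw [this, hA, ← sheet_mul_add (fun i => u i a) N kA]
    congr 1
    ring
  · ext l
    constructor
    · rintro ⟨i, rfl⟩
      have := h2 (3 * 0 + i)
      rw [sheet_mul_add] at this
      obtain ⟨n, k, hk⟩ := exists_eq_mul_add (3 * 0 + (i : ℤ) + ((kA : ℕ) - (kB : ℕ) : ℤ))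
      rw [hk, sheet_mul_add] at this
      refine ⟨k, ?_⟩
      simp only [Int.cast_zero, zero_mul, add_zero] at this
      simp only
      rw [this, lineOfAngle_add_int_mul_pi]
    · rintro ⟨j, rfl⟩
      obtain ⟨n, k, hk⟩ := exists_eq_mul_add (3 * 0 + (j : ℤ) - ((kA : ℕ) - (kB : ℕ) : ℤ))
      have := h2 (3 * n + k)
      rw [← hk, sub_add_cancel, hk, sheet_mul_add, sheet_mul_add,
        OrderIso.map_add_int_mul_pi h1] at this
      refine ⟨k, ?_⟩
      simp only [Int.cast_zero, zero_mul, add_zero] at this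
      simp only
      rw [← this, lineOfAngle_add_int_mul_pi]

/-- The boundary condition determines the shift, d = 2m. Since 3d = 6m sheets are 2m half-turns,
every oriented line closes up after three passages with m full turns. -/
theorem IsSorted.hasClosedPathIndex {a b βA βB : ℝ} {u : Fin 3 → ℝ → ℝ}
    (ha : IsSorted fun i => u i a) (hb : IsSorted fun i => u i b) {kA kB : Fin 3} {N : ℤ}
    (hA : βA = u kA a + N * Real.pi) (hB : βB = u kB b + N * Real.pi)
    {h : ℝ ≃o ℝ} (hh : IsGluing a b βA βB u h) {m : ℤ}
    (hm : ((kA : ℕ) - (kB : ℕ) : ℤ) = 2 * m) : HasClosedPathIndex a b u h (m / 3) := by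
  obtain ⟨d, hd⟩ := hb.exists_shift ha hh.equivariant hh.lines
  have hdm : d = 2 * m := by
    have h1 := hd (3 * N + kB)
    rw [sheet_mul_add, ← hB, hh.boundary, hA, ← sheet_mul_add (fun i => u i a) N kA] at h1
    have := ha.strictMono.injective h1
    omega
  refine ⟨3, m, by norm_num, by norm_num, fun i s his => ?_⟩
  -- The oriented line followed during passage `n` has sheet number 3 s(n) + i(n), and each gluing
  -- adds `d` to it.
  have step : ∀ n, 3 * s (n + 1) + (i (n + 1) : ℕ) = 3 * s n + (i n : ℕ) + d := by
    intro n
    apply ha.strictMono.injective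
    have h1 := his n
    rw [← sheet_mul_add (fun i => u i a), ← sheet_mul_add (fun i => u i b), hd] at h1
    exact h1
  have h0 := step 0
  have h1 := step 1
  have h2 := step 2
  rw [← sheet_mul_add (fun i => u i a), ← sheet_mul_add (fun i => u i a)]
  have : (3 * s 3 + (i 3 : ℕ) : ℤ) = 3 * s 0 + (i 0 : ℕ) + 3 * (2 * m) := by
    simp only [zero_add] at h0
    norm_num at h1 h2
    omega
  rw [this, sheet_add_mul]
  push_cast
  ring

/-! ### Renumbering the branches and turning them by half-turns -/

section Reindex

variable {a b βA βB : ℝ} {u u' : Fin 3 → ℝ → ℝ} (σ : Equiv.Perm (Fin 3)) (n : Fin 3 → ℤ)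

/-- The branches `u`, renumbered by `σ` and turned by `n` half-turns. -/
def reindex (u : Fin 3 → ℝ → ℝ) : Fin 3 → ℝ → ℝ := fun i t => u (σ i) t + n i * Real.pi

theorem lineOfAngle_reindex (i : Fin 3) (t : ℝ) :
    lineOfAngle (reindex σ n u i t) = lineOfAngle (u (σ i) t) :=
  lineOfAngle_add_int_mul_pi _ _

theorem reindex_symm (u : Fin 3 → ℝ → ℝ) :
    reindex σ n (reindex σ.symm (fun i => - n (σ.symm i)) u) = u := by
  funext i t
  simp [reindex]

theorem IsResolution.reindex {ε : ℝ} (h : IsResolution a b βA βB u ε u') :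
    IsResolution a b βA βB (reindex σ n u) ε (reindex σ n u') where
  cont i := (h.cont (σ i)).add continuousOn_const
  close i t ht := by
    simpa [_root_.reindex] using h.close (σ i) t ht
  distinct t ht i j hij := by
    simp only [lineOfAngle_reindex] at hij
    exact σ.injective (h.distinct t ht hij)
  tangent_start := by
    obtain ⟨i, hi⟩ := h.tangent_start
    exact ⟨σ.symm i, by rw [lineOfAngle_reindex, Equiv.apply_symm_apply, hi]⟩
  tangent_finish := by
    obtain ⟨i, hi⟩ := h.tangent_finish
    exact ⟨σ.symm i, by rw [lineOfAngle_reindex, Equiv.apply_symm_apply, hi]⟩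

theorem IsResolution.congr {ε : ℝ} {v : Fin 3 → ℝ → ℝ} (h : IsResolution a b βA βB u ε u')
    (huv : ∀ i, ∀ t ∈ Icc a b, u i t = v i t) : IsResolution a b βA βB v ε u' where
  cont := h.cont
  close i t ht := huv i t ht ▸ h.close i t ht
  distinct := h.distinct
  tangent_start := h.tangent_start
  tangent_finish := h.tangent_finish

theorem isGluing_reindex_iff {h : ℝ ≃o ℝ} :
    IsGluing a b βA βB (reindex σ n u) h ↔ IsGluing a b βA βB u h := by
  have key : (∀ t, h (t + Real.pi) = h t + Real.pi) →
      (((range fun i => lineOfAngle (h (reindex σ n u i b)))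
        = range fun i => lineOfAngle (reindex σ n u i a)) ↔
      ((range fun i => lineOfAngle (h (u i b))) = range fun i => lineOfAngle (u i a))) := by
    intro hh
    have e1 : (fun i => lineOfAngle (h (reindex σ n u i b)))
        = (fun i => lineOfAngle (h (u i b))) ∘ σ := by
      funext i
      simp only [reindex, Function.comp, OrderIso.map_add_int_mul_pi hh,
        lineOfAngle_add_int_mul_pi]
    have e2 : (fun i => lineOfAngle (reindex σ n u i a))
        = (fun i => lineOfAngle (u i a)) ∘ σ := by
      funext i
      simp only [lineOfAngle_reindex, Function.comp]
    rw [e1, e2, EquivLike.range_comp, EquivLike.range_comp]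
  exact ⟨fun hg => ⟨hg.equivariant, hg.boundary, (key hg.equivariant).1 hg.lines⟩,
    fun hg => ⟨hg.equivariant, hg.boundary, (key hg.equivariant).2 hg.lines⟩⟩

/-- The half-turns `n` are absorbed into the counters `s`, and the renumbering into the sequence
`i`. -/
theorem HasClosedPathIndex.reindex {h : ℝ ≃o ℝ} {ind : ℚ} (hu : HasClosedPathIndex a b u h ind) :
    HasClosedPathIndex a b (reindex σ n u) h ind := by
  obtain ⟨q, m, hq, hind, H⟩ := hu
  have e : ∀ (k : Fin 3) (s : ℤ) (t : ℝ), _root_.reindex σ n u k t + s * Real.pi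
      = u (σ k) t + ((s + n k : ℤ) : ℝ) * Real.pi := by
    intro k s t
    simp only [_root_.reindex]
    push_cast
    ring
  refine ⟨q, m, hq, hind, fun i s his => ?_⟩
  simp only [e] at his ⊢
  exact H (fun j => σ (i j)) (fun j => s j + n (i j)) his

end Reindex

/-! ### Continuous branches with values in the sheets of an ordered triple -/

/-- A continuous triple of angles on an interval, in increasing order and within a half-turn,
whose lines are distinct in the interior. -/
structure IsOrdered (a b : ℝ) (u : Fin 3 → ℝ → ℝ) : Prop where
  cont : ∀ i, ContinuousOn (u i) (Icc a b)
  le₀₁ : ∀ t ∈ Icc a b, u 0 t ≤ u 1 t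
  le₁₂ : ∀ t ∈ Icc a b, u 1 t ≤ u 2 t
  lt₂₀ : ∀ t ∈ Icc a b, u 2 t < u 0 t + Real.pi
  sorted : ∀ t ∈ Ioo a b, IsSorted fun i => u i t

theorem IsPreconnected.lt_of_forall_ne {s : Set ℝ} (hs : IsPreconnected s) {f g : ℝ → ℝ}
    (hf : ContinuousOn f s) (hg : ContinuousOn g s) (hne : ∀ t ∈ s, f t ≠ g t) {t₀ : ℝ}
    (ht₀ : t₀ ∈ s) (hlt : f t₀ < g t₀) : ∀ t ∈ s, f t < g t := by
  intro t ht
  by_contra hc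
  obtain ⟨c, hc1, hc2⟩ := hs.intermediate_value₂ ht₀ ht hf hg hlt.le (not_lt.1 hc)
  exact hne c hc1 hc2

/-- A continuous angle that stays on the sheets cannot cross the midline between two consecutive
ones. Its sheet number is thus constant inside the interval, and continuity extends the equality to
the endpoints, where sheets may merge. -/
theorem IsOrdered.exists_eq_sheet {a b : ℝ} (hab : a < b) {u : Fin 3 → ℝ → ℝ}
    (hu : IsOrdered a b u) {g : ℝ → ℝ} (hg : ContinuousOn g (Icc a b))
    (hgu : ∀ t ∈ Ioo a b, ∃ k, lineOfAngle (g t) = lineOfAngle (u k t)) :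
    ∃ (n : ℤ) (k : Fin 3), ∀ t ∈ Icc a b, g t = u k t + n * Real.pi := by
  have hsheet : ∀ t ∈ Ioo a b, ∃ N, g t = sheet (fun i => u i t) N := by
    intro t ht
    obtain ⟨k, hk⟩ := hgu t ht
    obtain ⟨n, hn⟩ := (lineOfAngle_eq_iff _ _).1 hk
    exact ⟨3 * n + k, by rw [sheet_mul_add, hn]⟩
  have hcont : ∀ N, ContinuousOn (fun t => sheet (fun i => u i t) N) (Icc a b) := fun N =>
    (hu.cont _).add continuousOn_const
  have hsub : Ioo a b ⊆ Icc a b := Ioo_subset_Icc_self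
  obtain ⟨t₀, ht₀⟩ : (Ioo a b).Nonempty := nonempty_Ioo.2 hab
  obtain ⟨N, hN⟩ := hsheet t₀ ht₀
  have hmono : ∀ t ∈ Ioo a b, StrictMono (sheet fun i => u i t) := fun t ht =>
    (hu.sorted t ht).strictMono
  set mid : ℤ → ℝ → ℝ := fun M t =>
    (sheet (fun i => u i t) M + sheet (fun i => u i t) (M + 1)) / 2 with hmid
  have hmidc : ∀ M, ContinuousOn (mid M) (Ioo a b) := fun M =>
    (((hcont M).add (hcont (M + 1))).div_const 2).mono hsub
  have hne : ∀ M, ∀ t ∈ Ioo a b, g t ≠ mid M t := by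
    intro M t ht h
    obtain ⟨K, hK⟩ := hsheet t ht
    have hm := hmono t ht
    have h1 : sheet (fun i => u i t) M < sheet (fun i => u i t) (M + 1) := hm (by omega)
    simp only [hmid] at h
    have h2 : M < K := hm.lt_iff_lt.1 (by rw [← hK]; linarith)
    have h3 : K < M + 1 := hm.lt_iff_lt.1 (by rw [← hK]; linarith)
    omega
  have h1 : ∀ t ∈ Ioo a b, g t < mid N t := by
    refine isPreconnected_Ioo.lt_of_forall_ne (hg.mono hsub) (hmidc N) (hne N) ht₀ ?_
    have := hmono t₀ ht₀ (show N < N + 1 by omega)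
    simp only [hmid]
    linarith
  have h2 : ∀ t ∈ Ioo a b, mid (N - 1) t < g t := by
    refine isPreconnected_Ioo.lt_of_forall_ne (hmidc (N - 1)) (hg.mono hsub)
      (fun t ht => (hne (N - 1) t ht).symm) ht₀ ?_
    have := hmono t₀ ht₀ (show N - 1 < N by omega)
    simp only [hmid, sub_add_cancel]
    linarith
  have heq : EqOn g (fun t => sheet (fun i => u i t) N) (Ioo a b) := by
    intro t ht
    obtain ⟨K, hK⟩ := hsheet t ht
    have hm := hmono t ht
    have e1 := h1 t ht
    have e2 := h2 t ht
    have e3 := hm (show N < N + 1 by omega)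
    have e4 := hm (show N - 1 < N by omega)
    simp only [hmid, sub_add_cancel] at e1 e2
    have h3 : K < N + 1 := hm.lt_iff_lt.1 (by rw [← hK]; linarith)
    have h4 : N - 1 < K := hm.lt_iff_lt.1 (by rw [← hK]; linarith)
    have : K = N := by omega
    rw [hK, this]
  have heq' : EqOn g (fun t => sheet (fun i => u i t) N) (Icc a b) :=
    heq.of_subset_closure hg (hcont N) hsub (closure_Ioo hab.ne).ge
  obtain ⟨n, k, rfl⟩ := exists_eq_mul_add N
  exact ⟨n, k, fun t ht => by rw [heq' ht]; exact sheet_mul_add _ _ _⟩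

theorem IsOrdered.exists_eq_reindex {a b : ℝ} (hab : a < b) {u θ : Fin 3 → ℝ → ℝ}
    (hu : IsOrdered a b u) (hθ : ∀ i, ContinuousOn (θ i) (Icc a b))
    (hd : ∀ t ∈ Ioo a b, Function.Injective fun i => lineOfAngle (θ i t))
    (hl : ∀ t ∈ Ioo a b, (range fun i => lineOfAngle (θ i t))
      = range fun i => lineOfAngle (u i t)) :
    ∃ (σ : Equiv.Perm (Fin 3)) (n : Fin 3 → ℤ), ∀ i, ∀ t ∈ Icc a b, reindex σ n u i t = θ i t := by
  have h : ∀ i, ∃ (n : ℤ) (k : Fin 3), ∀ t ∈ Icc a b, θ i t = u k t + n * Real.pi := by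
    intro i
    refine hu.exists_eq_sheet hab (hθ i) fun t ht => ?_
    have : lineOfAngle (θ i t) ∈ range fun i => lineOfAngle (u i t) := hl t ht ▸ mem_range_self i
    obtain ⟨k, hk⟩ := this
    exact ⟨k, hk.symm⟩
  choose n σ hσ using h
  -- Distinctness at one interior point suffices, because each sheet number is constant along the
  -- arc.
  have hinj : Function.Injective σ := by
    intro i j hij
    obtain ⟨t₀, ht₀⟩ : (Ioo a b).Nonempty := nonempty_Ioo.2 hab
    apply hd t₀ ht₀
    simp only
    rw [hσ i t₀ (Ioo_subset_Icc_self ht₀), hσ j t₀ (Ioo_subset_Icc_self ht₀), hij,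
      lineOfAngle_add_int_mul_pi, lineOfAngle_add_int_mul_pi]
  exact ⟨Equiv.ofBijective σ (Finite.injective_iff_bijective.1 hinj), n,
    fun i t ht => (hσ i t ht).symm⟩

/-! ### Resolutions of an ordered triple -/

/-- Every triple with distinct lines close to an ordered one is sorted. -/
theorem IsOrdered.exists_sorted_of_close {a b : ℝ} (hab : a < b) {u : Fin 3 → ℝ → ℝ}
    (hu : IsOrdered a b u) :
    ∃ ε : ℝ, 0 < ε ∧ ∀ u' : Fin 3 → ℝ → ℝ, (∀ i, ContinuousOn (u' i) (Icc a b)) →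
      (∀ i, ∀ t ∈ Icc a b, |u' i t - u i t| < ε) →
      (∀ t ∈ Icc a b, Function.Injective fun i => lineOfAngle (u' i t)) →
      ∀ t ∈ Icc a b, IsSorted fun i => u' i t := by
  obtain ⟨t₀, ht₀⟩ : (Ioo a b).Nonempty := nonempty_Ioo.2 hab
  have hs := hu.sorted t₀ ht₀
  have hs1 : u 0 t₀ < u 1 t₀ := hs.lt₀₁
  have hs2 : u 1 t₀ < u 2 t₀ := hs.lt₁₂
  have hs3 : u 2 t₀ < u 0 t₀ + Real.pi := hs.lt₂₀
  -- Half of the smallest gap at a single interior point: the order survives at `t₀`, and the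
  -- distinctness of the perturbed lines propagates it to the whole closed interval.
  set ε := min (min ((u 1 t₀ - u 0 t₀) / 2) ((u 2 t₀ - u 1 t₀) / 2))
    ((u 0 t₀ + Real.pi - u 2 t₀) / 2) with hε
  have ht₀' : t₀ ∈ Icc a b := Ioo_subset_Icc_self ht₀
  refine ⟨ε, lt_min (lt_min (by linarith) (by linarith)) (by linarith), fun u' hc hcl hd => ?_⟩
  have e1 : ε ≤ (u 1 t₀ - u 0 t₀) / 2 := (min_le_left _ _).trans (min_le_left _ _)
  have e2 : ε ≤ (u 2 t₀ - u 1 t₀) / 2 := (min_le_left _ _).trans (min_le_right _ _)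
  have e3 : ε ≤ (u 0 t₀ + Real.pi - u 2 t₀) / 2 := min_le_right _ _
  have c0 := abs_lt.1 (hcl 0 t₀ ht₀')
  have c1 := abs_lt.1 (hcl 1 t₀ ht₀')
  have c2 := abs_lt.1 (hcl 2 t₀ ht₀')
  have ne : ∀ i j : Fin 3, i ≠ j → ∀ n : ℤ, ∀ t ∈ Icc a b, u' i t ≠ u' j t + n * Real.pi :=
    fun i j hij n t ht h => hij (hd t ht ((lineOfAngle_eq_iff _ _).2 ⟨n, h⟩))
  have h01 := isPreconnected_Icc.lt_of_forall_ne (hc 0) (hc 1)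
    (fun t ht => by simpa using ne 0 1 (by decide) 0 t ht) ht₀' (by linarith)
  have h12 := isPreconnected_Icc.lt_of_forall_ne (hc 1) (hc 2)
    (fun t ht => by simpa using ne 1 2 (by decide) 0 t ht) ht₀' (by linarith)
  have h20 := isPreconnected_Icc.lt_of_forall_ne (g := fun t => u' 0 t + Real.pi) (hc 2)
    ((hc 0).add continuousOn_const)
    (fun t ht => by simpa using ne 2 0 (by decide) 1 t ht) ht₀' (by linarith)
  exact fun t ht => ⟨h01 t ht, h12 t ht, h20 t ht⟩

/-- If the tangent line is a simple extreme member of a triple, then the only line that a nearby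
triple may have in common with it is the corresponding one. -/
theorem exists_eq_tangent_of_close {v : Fin 3 → ℝ} (h01 : v 0 ≤ v 1) (h12 : v 1 ≤ v 2)
    (h20 : v 2 < v 0 + Real.pi) {k : Fin 3} (hk : k = 0 ∧ v 0 < v 1 ∨ k = 2 ∧ v 1 < v 2) :
    ∃ ε : ℝ, 0 < ε ∧ ∀ v' : Fin 3 → ℝ, (∀ i, |v' i - v i| < ε) →
      (∃ i, lineOfAngle (v' i) = lineOfAngle (v k)) → v' k = v k := by
  have hpi := Real.pi_pos
  have hdist : ∀ i, i ≠ k → 0 < |v i - v k| ∧ |v i - v k| < Real.pi := by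
    intro i hi
    rcases hk with ⟨rfl, h⟩ | ⟨rfl, h⟩
    · have : 0 < v i - v 0 ∧ v i - v 0 < Real.pi := by
        fin_cases i
        · exact absurd rfl hi
        · exact ⟨by change 0 < v 1 - v 0; linarith, by change v 1 - v 0 < _; linarith⟩
        · exact ⟨by change 0 < v 2 - v 0; linarith, by change v 2 - v 0 < _; linarith⟩
      rw [abs_of_pos this.1]
      exact this
    · have : v i - v 2 < 0 ∧ -Real.pi < v i - v 2 := by
        fin_cases i
        · exact ⟨by change v 0 - v 2 < 0; linarith, by change _ < v 0 - v 2; linarith⟩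
        · exact ⟨by change v 1 - v 2 < 0; linarith, by change _ < v 1 - v 2; linarith⟩
        · exact absurd rfl hi
      rw [abs_of_neg this.1]
      constructor <;> linarith
  -- For the other members, `ε` is at most their distance to the tangent line modulo π, measured
  -- either way round. For the tangent itself any bound below π excludes a jump by a half-turn.
  have hε : ∀ i, ∃ ε : ℝ, 0 < ε ∧ ε < Real.pi ∧ (i ≠ k → ε ≤ |v i - v k| ∧
      ε ≤ Real.pi - |v i - v k|) := by
    intro i
    by_cases hi : i = k
    · exact ⟨1, one_pos, by linarith [Real.pi_gt_three], fun h => absurd hi h⟩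
    · obtain ⟨h1, h2⟩ := hdist i hi
      exact ⟨min |v i - v k| (Real.pi - |v i - v k|), lt_min h1 (by linarith),
        (min_le_left _ _).trans_lt h2, fun _ => ⟨min_le_left _ _, min_le_right _ _⟩⟩
  choose e he1 he2 he3 using hε
  refine ⟨min (e 0) (min (e 1) (e 2)), lt_min (he1 0) (lt_min (he1 1) (he1 2)), ?_⟩
  rintro v' hcl ⟨i, hi⟩
  have hle : |v' i - v i| < e i := by
    refine (hcl i).trans_le ?_
    fin_cases i
    · exact min_le_left _ _
    · exact (min_le_right _ _).trans (min_le_left _ _)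
    · exact (min_le_right _ _).trans (min_le_right _ _)
  obtain ⟨n, hn⟩ := (lineOfAngle_eq_iff _ _).1 hi
  have hn0 : |v' i - v k| < Real.pi → n = 0 := by
    intro h
    rw [hn, add_sub_cancel_left, abs_mul, abs_of_pos hpi] at h
    have h1 : |(n : ℝ)| < 1 := by
      by_contra hc
      nlinarith
    rw [← Int.cast_abs] at h1
    exact Int.abs_lt_one_iff.1 (by exact_mod_cast h1)
  by_cases hik : i = k
  · subst hik
    rw [hn0 (hle.trans (he2 i))] at hn
    simpa using hn
  · exfalso
    obtain ⟨h1, h2⟩ := he3 i hik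
    have h3 : |v' i - v k| ≤ |v' i - v i| + |v i - v k| := abs_sub_le _ _ _
    rw [hn0 (by linarith)] at hn
    have h4 : v' i = v k := by simpa using hn
    rw [h4, abs_sub_comm] at hle
    linarith

theorem IsSorted.lineOfAngle_injective {v : Fin 3 → ℝ} (hv : IsSorted v) :
    Function.Injective fun i => lineOfAngle (v i) := by
  intro i j hij
  obtain ⟨n, hn⟩ := (lineOfAngle_eq_iff _ _).1 hij
  have h1 : sheet v (3 * 0 + i) = sheet v (3 * n + j) := by
    rw [sheet_mul_add, sheet_mul_add, ← hn]
    simp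
  have := hv.strictMono.injective h1
  have hi := i.isLt
  have hj := j.isLt
  apply Fin.ext
  omega

/-- An ordered triple is made sorted up to the endpoints by moving its extreme members away, with
weights `l` and `m` that are positive where the lines coincide. -/
theorem IsOrdered.exists_isResolution {a b βA βB : ℝ} (hab : a < b) {u : Fin 3 → ℝ → ℝ}
    (hu : IsOrdered a b u) {l m : ℝ → ℝ} (hl : ContinuousOn l (Icc a b))
    (hm : ContinuousOn m (Icc a b)) (hl0 : ∀ t ∈ Icc a b, 0 ≤ l t ∧ l t ≤ 1)
    (hm0 : ∀ t ∈ Icc a b, 0 ≤ m t ∧ m t ≤ 1)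
    (hl1 : ∀ t ∈ Icc a b, u 0 t = u 1 t → 0 < l t)
    (hm1 : ∀ t ∈ Icc a b, u 1 t = u 2 t → 0 < m t) {kA kB : Fin 3} {N : ℤ}
    (hA : βA = u kA a + N * Real.pi) (hB : βB = u kB b + N * Real.pi)
    (hA' : kA = 0 ∧ l a = 0 ∨ kA = 2 ∧ m a = 0) (hB' : kB = 0 ∧ l b = 0 ∨ kB = 2 ∧ m b = 0)
    {ε : ℝ} (hε : 0 < ε) : ∃ u', IsResolution a b βA βB u ε u' := by
  have haI : a ∈ Icc a b := left_mem_Icc.2 hab.le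
  have hbI : b ∈ Icc a b := right_mem_Icc.2 hab.le
  obtain ⟨t₀, ht₀, hmin⟩ := isCompact_Icc.exists_isMinOn
    (f := fun t => u 0 t + Real.pi - u 2 t) (nonempty_Icc.2 hab.le)
    (((hu.cont 0).add continuousOn_const).sub (hu.cont 2))
  set gap := u 0 t₀ + Real.pi - u 2 t₀ with hgap
  have hgap0 : 0 < gap := by have := hu.lt₂₀ t₀ ht₀; linarith
  have hgap1 : ∀ t ∈ Icc a b, gap ≤ u 0 t + Real.pi - u 2 t := fun t ht => hmin ht
  -- The two extreme members move apart by at most `δ` each, so a third of the smallest remaining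
  -- gap keeps the triple within a half-turn.
  set δ := min (ε / 2) (gap / 3) with hδ
  have hδ0 : 0 < δ := lt_min (by linarith) (by linarith)
  have hδ1 : δ ≤ ε / 2 := min_le_left _ _
  have hδ2 : δ ≤ gap / 3 := min_le_right _ _
  have hw : ∀ w : ℝ, 0 ≤ w ∧ w ≤ 1 → 0 ≤ δ * w ∧ δ * w ≤ δ := fun w hw =>
    ⟨mul_nonneg hδ0.le hw.1, mul_le_of_le_one_right hδ0.le hw.2⟩
  set u' : Fin 3 → ℝ → ℝ :=
    ![fun t => u 0 t - δ * l t, u 1, fun t => u 2 t + δ * m t] with hu'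
  have hsort : ∀ t ∈ Icc a b, IsSorted fun i => u' i t := by
    intro t ht
    have e1 := hw _ (hl0 t ht)
    have e2 := hw _ (hm0 t ht)
    have e3 := hgap1 t ht
    refine ⟨?_, ?_, ?_⟩
    · change u 0 t - δ * l t < u 1 t
      rcases (hu.le₀₁ t ht).eq_or_lt with h | h
      · have := mul_pos hδ0 (hl1 t ht h)
        linarith
      · linarith
    · change u 1 t < u 2 t + δ * m t
      rcases (hu.le₁₂ t ht).eq_or_lt with h | h
      · have := mul_pos hδ0 (hm1 t ht h)
        linarith
      · linarith
    · change u 2 t + δ * m t < u 0 t - δ * l t + Real.pi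
      linarith
  refine ⟨u', fun i => ?_, fun i t ht => ?_, fun t ht => (hsort t ht).lineOfAngle_injective,
    ⟨kA, ?_⟩, ⟨kB, ?_⟩⟩
  · fin_cases i
    · exact (hu.cont 0).sub (continuousOn_const.mul hl)
    · exact hu.cont 1
    · exact (hu.cont 2).add (continuousOn_const.mul hm)
  · have e1 := hw _ (hl0 t ht)
    have e2 := hw _ (hm0 t ht)
    fin_cases i
    · change |u 0 t - δ * l t - u 0 t| < ε
      rw [abs_lt]
      constructor <;> linarith
    · change |u 1 t - u 1 t| < ε
      simpa using hε
    · change |u 2 t + δ * m t - u 2 t| < ε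
      rw [abs_lt]
      constructor <;> linarith
  · rw [hA, lineOfAngle_add_int_mul_pi]
    rcases hA' with ⟨rfl, h⟩ | ⟨rfl, h⟩ <;> simp [hu', h]
  · rw [hB, lineOfAngle_add_int_mul_pi]
    rcases hB' with ⟨rfl, h⟩ | ⟨rfl, h⟩ <;> simp [hu', h]

/-- The conclusion of `HasBorderIndex` for one arc and one choice of branches, from an ordered
triple of branches that has a double line and a simple tangent line at each endpoint. -/
theorem IsOrdered.index_of_branches {a b βA βB : ℝ} (hab : a < b) {u θ : Fin 3 → ℝ → ℝ}
    (hu : IsOrdered a b u) (hθ : ∀ i, ContinuousOn (θ i) (Icc a b))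
    (hd : ∀ t ∈ Ioo a b, Function.Injective fun i => lineOfAngle (θ i t))
    (hl : ∀ t ∈ Ioo a b, (range fun i => lineOfAngle (θ i t))
      = range fun i => lineOfAngle (u i t))
    {kA kB : Fin 3} {N m : ℤ}
    (hA : βA = u kA a + N * Real.pi) (hB : βB = u kB b + N * Real.pi)
    (hk : (kA = 0 ∧ kB = 2 ∧ m = -1 ∧ u 0 a < u 1 a ∧ u 1 b < u 2 b) ∨
      (kA = 2 ∧ kB = 0 ∧ m = 1 ∧ u 1 a < u 2 a ∧ u 0 b < u 1 b)) :
    (∀ ε : ℝ, 0 < ε → ∃ θ' : Fin 3 → ℝ → ℝ, IsResolution a b βA βB θ ε θ') ∧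
      ∃ ε : ℝ, 0 < ε ∧ ∀ θ' : Fin 3 → ℝ → ℝ, IsResolution a b βA βB θ ε θ' →
        (∃ h : ℝ ≃o ℝ, IsGluing a b βA βB θ' h) ∧
        ∀ h : ℝ ≃o ℝ, IsGluing a b βA βB θ' h → HasClosedPathIndex a b θ' h (m / 3) := by
  have haI : a ∈ Icc a b := left_mem_Icc.2 hab.le
  have hbI : b ∈ Icc a b := right_mem_Icc.2 hab.le
  have hba : 0 < b - a := sub_pos.2 hab
  obtain ⟨σ, n, hσ⟩ := hu.exists_eq_reindex hab hθ hd hl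
  constructor
  · intro ε hε
    suffices ∃ u', IsResolution a b βA βB u ε u' by
      obtain ⟨u', hu'⟩ := this
      exact ⟨_, (hu'.reindex σ n).congr hσ⟩
    -- Each weight vanishes exactly at the endpoint where the extreme branch it moves is the
    -- tangent, and equals 1 at the other endpoint, where that branch may belong to the double line.
    set l : ℝ → ℝ := fun t => (t - a) / (b - a) with hl'
    set r : ℝ → ℝ := fun t => (b - t) / (b - a) with hr'
    have lc : ContinuousOn l (Icc a b) := by fun_prop
    have rc : ContinuousOn r (Icc a b) := by fun_prop
    have l0 : ∀ t ∈ Icc a b, 0 ≤ l t ∧ l t ≤ 1 := fun t ht =>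
      ⟨div_nonneg (by linarith [ht.1]) hba.le, (div_le_one hba).2 (by linarith [ht.2])⟩
    have r0 : ∀ t ∈ Icc a b, 0 ≤ r t ∧ r t ≤ 1 := fun t ht =>
      ⟨div_nonneg (by linarith [ht.2]) hba.le, (div_le_one hba).2 (by linarith [ht.1])⟩
    have lp : ∀ i j : Fin 3, u i a < u j a → ∀ t ∈ Icc a b, u i t = u j t → 0 < l t := by
      intro i j h2 t ht h3
      have : t ≠ a := by rintro rfl; exact h2.ne h3
      exact div_pos (by linarith [lt_of_le_of_ne ht.1 this.symm]) hba
    have rp : ∀ i j : Fin 3, u i b < u j b → ∀ t ∈ Icc a b, u i t = u j t → 0 < r t := by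
      intro i j h2 t ht h3
      have : t ≠ b := by rintro rfl; exact h2.ne h3
      exact div_pos (by linarith [lt_of_le_of_ne ht.2 this]) hba
    have la : l a = 0 := by simp [hl']
    have rb : r b = 0 := by simp [hr']
    rcases hk with ⟨rfl, rfl, -, h1, h2⟩ | ⟨rfl, rfl, -, h1, h2⟩
    · exact hu.exists_isResolution hab lc rc l0 r0
        (lp 0 1 h1) (rp 1 2 h2) hA hB (Or.inl ⟨rfl, la⟩) (Or.inr ⟨rfl, rb⟩) hε
    · exact hu.exists_isResolution hab rc lc r0 l0 (rp 0 1 h2)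
        (lp 1 2 h1) hA hB (Or.inr ⟨rfl, la⟩) (Or.inl ⟨rfl, rb⟩) hε
  · obtain ⟨ε₁, hε₁, H₁⟩ := hu.exists_sorted_of_close hab
    obtain ⟨ε₂, hε₂, H₂⟩ := exists_eq_tangent_of_close (v := fun i => u i a) (k := kA)
      (hu.le₀₁ a haI) (hu.le₁₂ a haI) (hu.lt₂₀ a haI) (by
        rcases hk with ⟨h, -, -, h1, -⟩ | ⟨h, -, -, h1, -⟩
        exacts [Or.inl ⟨h, h1⟩, Or.inr ⟨h, h1⟩])
    obtain ⟨ε₃, hε₃, H₃⟩ := exists_eq_tangent_of_close (v := fun i => u i b) (k := kB)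
      (hu.le₀₁ b hbI) (hu.le₁₂ b hbI) (hu.lt₂₀ b hbI) (by
        rcases hk with ⟨-, h, -, -, h1⟩ | ⟨-, h, -, -, h1⟩
        exacts [Or.inr ⟨h, h1⟩, Or.inl ⟨h, h1⟩])
    refine ⟨min ε₁ (min ε₂ ε₃), lt_min hε₁ (lt_min hε₂ hε₃), fun θ' hθ' => ?_⟩
    -- The given resolution is renumbered backwards, so as to be close to the ordered triple.
    set u' := reindex σ.symm (fun i => - n (σ.symm i)) θ' with hu'
    have hθu : reindex σ n u' = θ' := reindex_symm σ n θ'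
    have hres : IsResolution a b βA βB u (min ε₁ (min ε₂ ε₃)) u' := by
      refine (hθ'.reindex σ.symm fun i => - n (σ.symm i)).congr fun i t ht => ?_
      simp only [reindex, ← hσ _ t ht, Equiv.apply_symm_apply]
      push_cast
      ring
    have hsort := H₁ u' hres.cont (fun i t ht => (hres.close i t ht).trans_le (min_le_left _ _))
      hres.distinct
    have hA' : βA = u' kA a + N * Real.pi := by
      rw [hA, H₂ (fun i => u' i a) (fun i => (hres.close i a haI).trans_le
        ((min_le_right _ _).trans (min_le_left _ _)))]
      obtain ⟨i, hi⟩ := hres.tangent_start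
      exact ⟨i, by rw [hi, hA, lineOfAngle_add_int_mul_pi]⟩
    have hB' : βB = u' kB b + N * Real.pi := by
      rw [hB, H₃ (fun i => u' i b) (fun i => (hres.close i b hbI).trans_le
        ((min_le_right _ _).trans (min_le_right _ _)))]
      obtain ⟨i, hi⟩ := hres.tangent_finish
      exact ⟨i, by rw [hi, hB, lineOfAngle_add_int_mul_pi]⟩
    rw [← hθu]
    refine ⟨?_, fun h hh => ?_⟩
    · obtain ⟨h, hh⟩ := (hsort a haI).isGluing_exists (hsort b hbI) hA' hB'
      exact ⟨h, (isGluing_reindex_iff σ n).2 hh⟩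
    · refine ((hsort a haI).hasClosedPathIndex (hsort b hbI) hA' hB'
        ((isGluing_reindex_iff σ n).1 hh) ?_).reindex σ n
      rcases hk with ⟨rfl, rfl, rfl, -⟩ | ⟨rfl, rfl, rfl, -⟩ <;> rfl

/-! ### The roots of a cubic with real roots -/

/-- The roots in increasing order of `u ^ 3 + 3 c u ^ 2 + 3 b u + a`, if they are all real, by the
trigonometric formula. -/
def cubicRoots (a b c : ℝ) : Fin 3 → ℝ :=
  let P := c ^ 2 - b
  let T := Real.arccos (-(a - 3 * b * c + 2 * c ^ 3) / (2 * (P * √P))) / 3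
  ![-c + 2 * √P * Real.cos (T + 2 * (Real.pi / 3)), -c + 2 * √P * Real.cos (2 * (Real.pi / 3) - T),
    -c + 2 * √P * Real.cos T]

section CubicRoots

variable {a b c : ℝ}

/-- With u = -c + 2√P x the cubic becomes 4x³ - 3x = cos 3T, up to a factor; its solutions are the
cosines of T and T ± 2π/3. The hypothesis `hD` puts the argument of `arccos` in [-1, 1]. -/
theorem cubicRoots_factor (hP : 0 < c ^ 2 - b)
    (hD : (a - 3 * b * c + 2 * c ^ 3) ^ 2 ≤ 4 * (c ^ 2 - b) ^ 3) (u : ℝ) :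
    u ^ 3 + 3 * c * u ^ 2 + 3 * b * u + a
      = (u - cubicRoots a b c 0) * (u - cubicRoots a b c 1) * (u - cubicRoots a b c 2) := by
  simp only [cubicRoots]
  set P := c ^ 2 - b with hPdef
  set R := a - 3 * b * c + 2 * c ^ 3 with hR
  set s := √P with hs
  have hs2 : s ^ 2 = P := Real.sq_sqrt hP.le
  have hs0 : 0 < s := Real.sqrt_pos.2 hP
  have hden : 0 < 2 * (P * s) := by positivity
  have hq : (-R / (2 * (P * s))) ^ 2 ≤ 1 := by
    rw [div_pow, div_le_one (by positivity)]
    calc (-R) ^ 2 = R ^ 2 := by ring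
      _ ≤ 4 * P ^ 3 := hD
      _ = (2 * (P * s)) ^ 2 := by rw [← hs2]; ring
  have hq' := abs_le.1 ((sq_le_one_iff_abs_le_one _).1 hq)
  set T := Real.arccos (-R / (2 * (P * s))) / 3 with hT
  have hcos : Real.cos (3 * T) * (2 * (P * s)) = -R := by
    rw [hT, mul_div_cancel₀ _ (by norm_num : (3 : ℝ) ≠ 0), Real.cos_arccos hq'.1 hq'.2,
      div_mul_cancel₀ _ hden.ne']
  rw [Real.cos_three_mul] at hcos
  have hc23 : Real.cos (2 * (Real.pi / 3)) = -1 / 2 := by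
    rw [Real.cos_two_mul, Real.cos_pi_div_three]; norm_num
  have hs23 : Real.sin (2 * (Real.pi / 3)) = √3 / 2 := by
    rw [Real.sin_two_mul, Real.cos_pi_div_three, Real.sin_pi_div_three]; ring
  have h3 : √(3 : ℝ) ^ 2 = 3 := Real.sq_sqrt (by norm_num)
  have hsc := Real.sin_sq_add_cos_sq T
  simp only [Matrix.cons_val_zero, Matrix.cons_val_one, Matrix.cons_val]
  rw [Real.cos_add, Real.cos_sub, hc23, hs23]
  generalize √(3 : ℝ) = w at *
  generalize Real.cos T = x at *
  generalize Real.sin T = y at *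
  have hb : b = c ^ 2 - s ^ 2 := by rw [hs2, hPdef]; ring
  have ha : a = 3 * b * c - 2 * c ^ 3 - (4 * x ^ 3 - 3 * x) * (2 * (s ^ 2 * s)) := by
    rw [hs2]; linear_combination -hR + hcos
  have hy : w ^ 2 * y ^ 2 = 3 * (1 - x ^ 2) := by rw [h3]; linear_combination 3 * hsc
  rw [ha, hb]
  linear_combination (s ^ 2 * (u + c - 2 * s * x)) * hy

/-- Since 0 ≤ T ≤ π/3, the angles satisfy T ≤ 2π/3 - T ≤ T + 2π/3 ≤ π, and the cosine decreases
there. -/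
theorem cubicRoots_le (hP : 0 < c ^ 2 - b) :
    cubicRoots a b c 0 ≤ cubicRoots a b c 1 ∧ cubicRoots a b c 1 ≤ cubicRoots a b c 2 := by
  simp only [cubicRoots, Matrix.cons_val_zero, Matrix.cons_val_one, Matrix.cons_val]
  set y := -(a - 3 * b * c + 2 * c ^ 3) / (2 * ((c ^ 2 - b) * √(c ^ 2 - b)))
  have h0 := Real.arccos_nonneg y
  have h1 := Real.arccos_le_pi y
  have hs0 : 0 < √(c ^ 2 - b) := Real.sqrt_pos.2 hP
  constructor
  · have := Real.cos_le_cos_of_nonneg_of_le_pi (x := 2 * (Real.pi / 3) - Real.arccos y / 3)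
      (y := Real.arccos y / 3 + 2 * (Real.pi / 3)) (by linarith) (by linarith) (by linarith)
    gcongr
  · have := Real.cos_le_cos_of_nonneg_of_le_pi (x := Real.arccos y / 3)
      (y := 2 * (Real.pi / 3) - Real.arccos y / 3) (by linarith) (by linarith) (by linarith)
    gcongr

theorem cubicRoots_lt (hP : 0 < c ^ 2 - b)
    (hD : (a - 3 * b * c + 2 * c ^ 3) ^ 2 < 4 * (c ^ 2 - b) ^ 3) :
    cubicRoots a b c 0 < cubicRoots a b c 1 ∧ cubicRoots a b c 1 < cubicRoots a b c 2 := by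
  have hs0 : 0 < √(c ^ 2 - b) := Real.sqrt_pos.2 hP
  have hs2 : √(c ^ 2 - b) ^ 2 = c ^ 2 - b := Real.sq_sqrt hP.le
  have hq : (-(a - 3 * b * c + 2 * c ^ 3) / (2 * ((c ^ 2 - b) * √(c ^ 2 - b)))) ^ 2 < 1 := by
    have hden : 0 < 2 * ((c ^ 2 - b) * √(c ^ 2 - b)) := mul_pos two_pos (mul_pos hP hs0)
    rw [div_pow, div_lt_one (pow_pos hden 2)]
    calc (-(a - 3 * b * c + 2 * c ^ 3)) ^ 2 = (a - 3 * b * c + 2 * c ^ 3) ^ 2 := by ring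
      _ < 4 * (c ^ 2 - b) ^ 3 := hD
      _ = 4 * ((c ^ 2 - b) ^ 2 * √(c ^ 2 - b) ^ 2) := by rw [hs2]; ring
      _ = (2 * ((c ^ 2 - b) * √(c ^ 2 - b))) ^ 2 := by ring
  have hq' := abs_lt.1 ((sq_lt_one_iff_abs_lt_one _).1 hq)
  simp only [cubicRoots, Matrix.cons_val_zero, Matrix.cons_val_one, Matrix.cons_val]
  set y := -(a - 3 * b * c + 2 * c ^ 3) / (2 * ((c ^ 2 - b) * √(c ^ 2 - b)))
  have h0 : 0 < Real.arccos y := Real.arccos_pos.2 hq'.2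
  have h1 : Real.arccos y < Real.pi := by
    refine lt_of_le_of_ne (Real.arccos_le_pi y) fun h => ?_
    have := Real.arccos_eq_pi.1 h
    linarith
  constructor
  · have := Real.cos_lt_cos_of_nonneg_of_le_pi (x := 2 * (Real.pi / 3) - Real.arccos y / 3)
      (y := Real.arccos y / 3 + 2 * (Real.pi / 3)) (by linarith) (by linarith) (by linarith)
    gcongr
  · have := Real.cos_lt_cos_of_nonneg_of_le_pi (x := Real.arccos y / 3)
      (y := 2 * (Real.pi / 3) - Real.arccos y / 3) (by linarith) (by linarith) (by linarith)
    gcongr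

/-- Double roots do no harm, because `arccos` is continuous up to ±1. Only the triple root P = 0 has
to be excluded. -/
theorem continuousOn_cubicRoots {X : Type*} [TopologicalSpace X] {s : Set X} {a b c : X → ℝ}
    (ha : ContinuousOn a s) (hb : ContinuousOn b s) (hc : ContinuousOn c s)
    (hP : ∀ x ∈ s, 0 < c x ^ 2 - b x) (k : Fin 3) :
    ContinuousOn (fun x => cubicRoots (a x) (b x) (c x) k) s := by
  have hPc : ContinuousOn (fun x => c x ^ 2 - b x) s := (hc.pow 2).sub hb
  have hsc : ContinuousOn (fun x => √(c x ^ 2 - b x)) s := hPc.sqrt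
  have hT : ContinuousOn (fun x => Real.arccos (-(a x - 3 * b x * c x + 2 * c x ^ 3)
      / (2 * ((c x ^ 2 - b x) * √(c x ^ 2 - b x)))) / 3) s := by
    refine ContinuousOn.div_const (Real.continuous_arccos.comp_continuousOn (ContinuousOn.div ?_
      (continuousOn_const.mul (hPc.mul hsc)) fun x hx => ?_)) 3
    · fun_prop
    · exact (mul_pos two_pos (mul_pos (hP x hx) (Real.sqrt_pos.2 (hP x hx)))).ne'
  have key : ∀ g : ℝ → ℝ, Continuous g → ContinuousOn (fun x => -c x + 2 * √(c x ^ 2 - b x) *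
      Real.cos (g (Real.arccos (-(a x - 3 * b x * c x + 2 * c x ^ 3)
      / (2 * ((c x ^ 2 - b x) * √(c x ^ 2 - b x)))) / 3))) s := fun g hg =>
    hc.neg.add ((continuousOn_const.mul hsc).mul
      (Real.continuous_cos.comp_continuousOn (hg.comp_continuousOn hT)))
  fin_cases k
  · exact key (fun T => T + 2 * (Real.pi / 3)) (by fun_prop)
  · exact key (fun T => 2 * (Real.pi / 3) - T) (by fun_prop)
  · exact key (fun T => T) (by fun_prop)

/-- The roots, in increasing order, of a cubic with a double root `α` and a simple root `β`. -/
theorem roots_of_double {x y z α β : ℝ} (hxy : x ≤ y) (hyz : y ≤ z) (hne : α ≠ β)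
    (h : ∀ u, (u - x) * (u - y) * (u - z) = (u - α) ^ 2 * (u - β)) :
    (α < β → x = α ∧ y = α ∧ z = β) ∧ (β < α → x = β ∧ y = α ∧ z = α) := by
  -- The second difference at -1, 0, 1 isolates the coefficient of u².
  have hsum : x + y + z = 2 * α + β := by
    linear_combination (h 1 + h (-1) - 2 * h 0) * (-1 / 2)
  have hα : α - x = 0 ∨ α - y = 0 ∨ α - z = 0 := by
    have := h α
    simpa [or_assoc] using this
  have hβ : β - x = 0 ∨ β - y = 0 ∨ β - z = 0 := by
    have := h β
    simpa [or_assoc] using this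
  constructor <;> intro hlt <;> rcases hα with h1 | h1 | h1 <;> rcases hβ with h2 | h2 | h2 <;>
    first
    | (exfalso; apply hne; linarith)
    | (refine ⟨?_, ?_, ?_⟩ <;> linarith)

end CubicRoots

/-! ### Partial derivatives of smooth functions of two variables -/

theorem contDiffOn_fderiv_apply {U : Set (ℝ × ℝ)} (hU : IsOpen U) {g : ℝ × ℝ → ℝ}
    (hg : ContDiffOn ℝ ∞ g U) (v : ℝ × ℝ) : ContDiffOn ℝ ∞ (fun x => fderiv ℝ g x v) U :=
  (hg.fderiv_of_isOpen hU (by simp)).clm_apply contDiffOn_const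

theorem contDiffOn_pd {U : Set (ℝ × ℝ)} (hU : IsOpen U) {f : ℝ × ℝ → ℝ}
    (hf : ContDiffOn ℝ ∞ f U) (i j : ℕ) : ContDiffOn ℝ ∞ (pd i j f) U := by
  unfold pd
  induction i with
  | zero =>
    induction j with
    | zero => exact hf
    | succ j ih =>
      rw [Function.iterate_zero, id] at ih ⊢
      rw [Function.iterate_succ_apply']
      exact contDiffOn_fderiv_apply hU ih _
  | succ i ih =>
    rw [Function.iterate_succ_apply']
    exact contDiffOn_fderiv_apply hU ih _

theorem fderiv_fderiv_apply_comm {U : Set (ℝ × ℝ)} (hU : IsOpen U) {g : ℝ × ℝ → ℝ}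
    (hg : ContDiffOn ℝ ∞ g U) {x : ℝ × ℝ} (hx : x ∈ U) (v w : ℝ × ℝ) :
    fderiv ℝ (fun y => fderiv ℝ g y v) x w = fderiv ℝ (fun y => fderiv ℝ g y w) x v := by
  have h1 : ContDiffAt ℝ ∞ g x := hg.contDiffAt (hU.mem_nhds hx)
  have h2 : DifferentiableAt ℝ (fderiv ℝ g) x :=
    ((hg.fderiv_of_isOpen (m := ∞) hU (by simp)).contDiffAt
      (hU.mem_nhds hx)).differentiableAt (by simp)
  have h3 : IsSymmSndFDerivAt ℝ g x := h1.isSymmSndFDerivAt (by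
    simpa using WithTop.coe_le_coe.2 (le_top : (2 : ℕ∞) ≤ ⊤))
  rw [fderiv_clm_apply h2 (differentiableAt_const v),
    fderiv_clm_apply h2 (differentiableAt_const w)]
  simpa using h3 w v

theorem fderiv_apply_eq (g : ℝ × ℝ → ℝ) (x v : ℝ × ℝ) :
    fderiv ℝ g x v = v.1 * fderiv ℝ g x (1, 0) + v.2 * fderiv ℝ g x (0, 1) := by
  have : v = v.1 • ((1, 0) : ℝ × ℝ) + v.2 • ((0, 1) : ℝ × ℝ) := by
    apply Prod.ext <;> simp
  conv_lhs => rw [this]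
  rw [map_add, map_smul, map_smul, smul_eq_mul, smul_eq_mul]

theorem fderiv_pd_fst (f : ℝ × ℝ → ℝ) (i j : ℕ) (x : ℝ × ℝ) :
    fderiv ℝ (pd i j f) x (1, 0) = pd (i + 1) j f x := by
  unfold pd
  rw [Function.iterate_succ_apply']

/-- `pd` differentiates in y first, so one more y-derivative must be carried past the x-derivatives
by symmetry of the second derivative. -/
theorem fderiv_pd_snd {U : Set (ℝ × ℝ)} (hU : IsOpen U) {f : ℝ × ℝ → ℝ}
    (hf : ContDiffOn ℝ ∞ f U) (i j : ℕ) {x : ℝ × ℝ} (hx : x ∈ U) :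
    fderiv ℝ (pd i j f) x (0, 1) = pd i (j + 1) f x := by
  induction i generalizing x with
  | zero =>
    unfold pd
    rw [Function.iterate_succ_apply']
    rfl
  | succ i ih =>
    have e : pd (i + 1) j f = fun y => fderiv ℝ (pd i j f) y (1, 0) := by
      funext y
      rw [fderiv_pd_fst]
    have e' : (fun y => fderiv ℝ (pd i j f) y (0, 1)) =ᶠ[𝓝 x] pd i (j + 1) f := by
      filter_upwards [hU.mem_nhds hx] with y hy using ih hy
    rw [e, fderiv_fderiv_apply_comm hU (contDiffOn_pd hU hf i j) hx, e'.fderiv_eq,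
      fderiv_pd_fst]

theorem contDiffOn_hessian {U : Set (ℝ × ℝ)} (hU : IsOpen U) {f : ℝ × ℝ → ℝ}
    (hf : ContDiffOn ℝ ∞ f U) : ContDiffOn ℝ ∞ (hessian f) U :=
  ((contDiffOn_pd hU hf 2 0).mul (contDiffOn_pd hU hf 0 2)).sub
    ((contDiffOn_pd hU hf 1 1).pow 2)

theorem fderiv_hessian_apply {U : Set (ℝ × ℝ)} (hU : IsOpen U) {f : ℝ × ℝ → ℝ}
    (hf : ContDiffOn ℝ ∞ f U) {x : ℝ × ℝ} (hx : x ∈ U) (v : ℝ × ℝ) :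
    fderiv ℝ (hessian f) x v = fderiv ℝ (pd 2 0 f) x v * pd 0 2 f x
      + pd 2 0 f x * fderiv ℝ (pd 0 2 f) x v - 2 * pd 1 1 f x * fderiv ℝ (pd 1 1 f) x v := by
  have hd : ∀ i j, HasFDerivAt (pd i j f) (fderiv ℝ (pd i j f) x) x := fun i j =>
    (((contDiffOn_pd hU hf i j).contDiffAt (hU.mem_nhds hx)).differentiableAt
      (by simp)).hasFDerivAt
  have h := ((hd 2 0).mul (hd 0 2)).sub ((hd 1 1).pow 2)
  have h' : HasFDerivAt (hessian f) _ x := h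
  rw [h'.fderiv]
  simp
  ring

/-! ### The forms in an orthonormal frame

The frame is formed by the unit vectors of angles `φ` and `φ + π / 2`. -/

section Frame

variable (f : ℝ × ℝ → ℝ) (φ : ℝ) (x : ℝ × ℝ)

/-- The coefficient of the first vector of the frame in the second fundamental form. -/
def quadE : ℝ :=
  pd 2 0 f x * Real.cos φ ^ 2 + 2 * pd 1 1 f x * Real.cos φ * Real.sin φ
    + pd 0 2 f x * Real.sin φ ^ 2

/-- The mixed coefficient of the second fundamental form in the frame. -/
def quadF : ℝ :=
  -pd 2 0 f x * Real.cos φ * Real.sin φ + pd 1 1 f x * (Real.cos φ ^ 2 - Real.sin φ ^ 2)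
    + pd 0 2 f x * Real.cos φ * Real.sin φ

/-- The coefficient of the second vector of the frame in the second fundamental form. -/
def quadG : ℝ :=
  pd 2 0 f x * Real.sin φ ^ 2 - 2 * pd 1 1 f x * Real.cos φ * Real.sin φ
    + pd 0 2 f x * Real.cos φ ^ 2

/-- The third derivative of `f` along the first vector of the frame. -/
def third₀ : ℝ :=
  pd 3 0 f x * Real.cos φ ^ 3 + 3 * pd 2 1 f x * Real.cos φ ^ 2 * Real.sin φ
    + 3 * pd 1 2 f x * Real.cos φ * Real.sin φ ^ 2 + pd 0 3 f x * Real.sin φ ^ 3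

/-- The third derivative of `f`, twice along the first vector of the frame and once along the
second one. -/
def third₁ : ℝ :=
  -pd 3 0 f x * Real.cos φ ^ 2 * Real.sin φ
    + pd 2 1 f x * (Real.cos φ ^ 3 - 2 * Real.cos φ * Real.sin φ ^ 2)
    + pd 1 2 f x * (2 * Real.cos φ ^ 2 * Real.sin φ - Real.sin φ ^ 3)
    + pd 0 3 f x * Real.cos φ * Real.sin φ ^ 2

/-- The third derivative of `f`, once along the first vector of the frame and twice along the
second one. -/
def third₂ : ℝ :=
  pd 3 0 f x * Real.cos φ * Real.sin φ ^ 2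
    + pd 2 1 f x * (Real.sin φ ^ 3 - 2 * Real.cos φ ^ 2 * Real.sin φ)
    + pd 1 2 f x * (Real.cos φ ^ 3 - 2 * Real.cos φ * Real.sin φ ^ 2)
    + pd 0 3 f x * Real.cos φ ^ 2 * Real.sin φ

/-- The third derivative of `f` along the second vector of the frame. -/
def third₃ : ℝ :=
  -pd 3 0 f x * Real.sin φ ^ 3 + 3 * pd 2 1 f x * Real.cos φ * Real.sin φ ^ 2
    - 3 * pd 1 2 f x * Real.cos φ ^ 2 * Real.sin φ + pd 0 3 f x * Real.cos φ ^ 3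

/-- The derivative of `G` along the first vector of the frame. -/
def along (G : ℝ × ℝ → ℝ) : ℝ :=
  fderiv ℝ G x (1, 0) * Real.cos φ + fderiv ℝ G x (0, 1) * Real.sin φ

/-- The derivative of `G` along the second vector of the frame. -/
def across (G : ℝ × ℝ → ℝ) : ℝ :=
  -fderiv ℝ G x (1, 0) * Real.sin φ + fderiv ℝ G x (0, 1) * Real.cos φ

/-- The coefficient of `s ^ 3` in the fundamental cubic form, in coordinates `(s, t)`. -/
def coefA : ℝ := 2 / 3 * hessian f x * third₀ f φ x - quadE f φ x * along φ x (hessian f) / 2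

/-- The coefficient of `3 s ^ 2 t` in the fundamental cubic form, in coordinates `(s, t)`. -/
def coefB : ℝ := (2 * hessian f x * third₁ f φ x
  - (quadE f φ x * across φ x (hessian f) + 2 * quadF f φ x * along φ x (hessian f)) / 2) / 3

/-- The coefficient of `3 s t ^ 2` in the fundamental cubic form, in coordinates `(s, t)`. -/
def coefC : ℝ := (2 * hessian f x * third₂ f φ x
  - (2 * quadF f φ x * across φ x (hessian f) + quadG f φ x * along φ x (hessian f)) / 2) / 3

/-- The coefficient of `t ^ 3` in the fundamental cubic form, in coordinates `(s, t)`. -/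
def coefD : ℝ := 2 / 3 * hessian f x * third₃ f φ x - quadG f φ x * across φ x (hessian f) / 2

theorem fderiv_frame (G : ℝ × ℝ → ℝ) (s t : ℝ) :
    fderiv ℝ G x (s * Real.cos φ - t * Real.sin φ, s * Real.sin φ + t * Real.cos φ)
      = s * along φ x G + t * across φ x G := by
  rw [fderiv_apply_eq, along, across]
  ring

theorem secondForm_frame (s t : ℝ) :
    secondForm f x (s * Real.cos φ - t * Real.sin φ, s * Real.sin φ + t * Real.cos φ)
      = (quadE f φ x * s ^ 2 + 2 * quadF f φ x * s * t + quadG f φ x * t ^ 2) / 2 := by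
  rw [secondForm, quadE, quadF, quadG]
  ring

theorem cubicPart_frame (s t : ℝ) :
    cubicPart f x (s * Real.cos φ - t * Real.sin φ, s * Real.sin φ + t * Real.cos φ)
      = (third₀ f φ x * s ^ 3 + 3 * third₁ f φ x * s ^ 2 * t + 3 * third₂ f φ x * s * t ^ 2
        + third₃ f φ x * t ^ 3) / 6 := by
  rw [cubicPart, third₀, third₁, third₂, third₃]
  ring

theorem cubicForm_frame (s t : ℝ) :
    cubicForm f x (s * Real.cos φ - t * Real.sin φ, s * Real.sin φ + t * Real.cos φ)
      = coefA f φ x * s ^ 3 + 3 * coefB f φ x * s ^ 2 * t + 3 * coefC f φ x * s * t ^ 2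
        + coefD f φ x * t ^ 3 := by
  rw [cubicForm, cubicPart_frame, secondForm_frame, fderiv_frame, coefA, coefB, coefC, coefD]
  ring

theorem exists_frame (v : ℝ × ℝ) : ∃ s t : ℝ,
    v = (s * Real.cos φ - t * Real.sin φ, s * Real.sin φ + t * Real.cos φ) := by
  have h := Real.sin_sq_add_cos_sq φ
  refine ⟨v.1 * Real.cos φ + v.2 * Real.sin φ, -v.1 * Real.sin φ + v.2 * Real.cos φ,
    Prod.ext ?_ ?_⟩
  · linear_combination (-v.1) * h
  · linear_combination (-v.2) * h

theorem hessian_frame : hessian f x = quadE f φ x * quadG f φ x - quadF f φ x ^ 2 := by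
  have h := Real.sin_sq_add_cos_sq φ
  have : quadE f φ x * quadG f φ x - quadF f φ x ^ 2
      = (Real.sin φ ^ 2 + Real.cos φ ^ 2) ^ 2 * hessian f x := by
    rw [quadE, quadF, quadG, hessian]
    ring
  rw [this, h]
  ring

variable {f x}

/-- The frame does not depend on the point, so this is the product rule for EG - F², the third
derivatives being those of E, F, G. -/
theorem along_hessian {U : Set (ℝ × ℝ)} (hU : IsOpen U) (hf : ContDiffOn ℝ ∞ f U) (hx : x ∈ U) :
    along φ x (hessian f) = third₀ f φ x * quadG f φ x + quadE f φ x * third₂ f φ x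
      - 2 * quadF f φ x * third₁ f φ x := by
  have h := Real.sin_sq_add_cos_sq φ
  have : third₀ f φ x * quadG f φ x + quadE f φ x * third₂ f φ x
      - 2 * quadF f φ x * third₁ f φ x
      = (Real.sin φ ^ 2 + Real.cos φ ^ 2) ^ 2 * along φ x (hessian f) := by
    simp only [along, fderiv_hessian_apply hU hf hx, fderiv_pd_fst,
      fderiv_pd_snd hU hf _ _ hx, quadE, quadF, quadG, third₀, third₁, third₂]
    ring
  rw [this, h]
  ring

theorem across_hessian {U : Set (ℝ × ℝ)} (hU : IsOpen U) (hf : ContDiffOn ℝ ∞ f U)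
    (hx : x ∈ U) :
    across φ x (hessian f) = third₁ f φ x * quadG f φ x + quadE f φ x * third₃ f φ x
      - 2 * quadF f φ x * third₂ f φ x := by
  have h := Real.sin_sq_add_cos_sq φ
  have : third₁ f φ x * quadG f φ x + quadE f φ x * third₃ f φ x
      - 2 * quadF f φ x * third₂ f φ x
      = (Real.sin φ ^ 2 + Real.cos φ ^ 2) ^ 2 * across φ x (hessian f) := by
    simp only [across, fderiv_hessian_apply hU hf hx, fderiv_pd_fst,
      fderiv_pd_snd hU hf _ _ hx, quadE, quadF, quadG, third₁, third₂, third₃]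
    ring
  rw [this, h]
  ring

/-- The fundamental cubic form is apolar to the second fundamental form. -/
theorem apolar {U : Set (ℝ × ℝ)} (hU : IsOpen U) (hf : ContDiffOn ℝ ∞ f U) (hx : x ∈ U) :
    quadG f φ x * coefA f φ x - 2 * quadF f φ x * coefB f φ x + quadE f φ x * coefC f φ x = 0 ∧
    quadG f φ x * coefB f φ x - 2 * quadF f φ x * coefC f φ x + quadE f φ x * coefD f φ x = 0 := by
  simp only [coefA, coefB, coefC, coefD, along_hessian φ hU hf hx, across_hessian φ hU hf hx,
    hessian_frame f φ x]
  constructor <;> ring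

/-- The coefficients of the fundamental cubic form and its discriminant, in terms of an apolar
quadratic form. -/
theorem discr_of_apolar {E F G A B C D : ℝ} (hG : G ≠ 0) (hD : D ≠ 0)
    (h1 : G * A - 2 * F * B + E * C = 0) (h2 : G * B - 2 * F * C + E * D = 0) :
    (C / D) ^ 2 - B / D = (C / D - F / G) ^ 2 + (E * G - F ^ 2) / G ^ 2 ∧
    4 * ((C / D) ^ 2 - B / D) ^ 3 - (A / D - 3 * (B / D) * (C / D) + 2 * (C / D) ^ 3) ^ 2
      = 4 * ((E * G - F ^ 2) / G ^ 2) * ((C / D) ^ 2 - B / D) ^ 2 := by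
  obtain ⟨c, rfl⟩ : ∃ c, C = c * D := ⟨C / D, by field_simp⟩
  obtain ⟨b, rfl⟩ : ∃ b, B = b * D := ⟨B / D, by field_simp⟩
  obtain ⟨a, rfl⟩ : ∃ a, A = a * D := ⟨A / D, by field_simp⟩
  obtain ⟨e, rfl⟩ : ∃ e, E = e * G := ⟨E / G, by field_simp⟩
  obtain ⟨f, rfl⟩ : ∃ f, F = f * G := ⟨F / G, by field_simp⟩
  have hη : (e * G * G - (f * G) ^ 2) / G ^ 2 = e - f ^ 2 := by field_simp
  rw [hη, mul_div_cancel_right₀ _ hD, mul_div_cancel_right₀ _ hD, mul_div_cancel_right₀ _ hD,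
    mul_div_cancel_right₀ _ hG]
  -- After normalisation, apolarity expresses `b` and then `a` through `c` and the quadratic form,
  -- and both claims become polynomial identities.
  have hb : b = 2 * f * c - e := by
    have : G * D * (b - 2 * f * c + e) = 0 := by linear_combination h2
    have := (mul_eq_zero.1 this).resolve_left (mul_ne_zero hG hD)
    linarith
  have ha : a = 2 * f * b - e * c := by
    have : G * D * (a - 2 * f * b + e * c) = 0 := by linear_combination h1
    have := (mul_eq_zero.1 this).resolve_left (mul_ne_zero hG hD)
    linarith
  subst hb
  subst ha
  constructor <;> ring

/-- At a parabolic point the fundamental cubic form is the product of the asymptotic direction,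
counted twice, and the tangent to the parabolic curve. -/
theorem coef_of_hessian_eq_zero (h0 : hessian f x = 0) (hG : quadG f φ x ≠ 0)
    (hd : across φ x (hessian f) ≠ 0) (u : ℝ) :
    coefC f φ x / coefD f φ x - quadF f φ x / quadG f φ x
      = (along φ x (hessian f) / across φ x (hessian f) - quadF f φ x / quadG f φ x) / 3 ∧
    u ^ 3 + 3 * (coefC f φ x / coefD f φ x) * u ^ 2 + 3 * (coefB f φ x / coefD f φ x) * u
      + coefA f φ x / coefD f φ x
    = (u - -(quadF f φ x / quadG f φ x)) ^ 2
      * (u - -(along φ x (hessian f) / across φ x (hessian f))) := by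
  have hE : quadE f φ x = quadF f φ x ^ 2 / quadG f φ x := by
    rw [hessian_frame f φ x] at h0
    rw [eq_div_iff hG]
    linarith
  simp only [coefA, coefB, coefC, coefD, h0, hE]
  constructor
  · field_simp
    ring
  · field_simp
    ring

end Frame

/-! ### Small circles centred at a regular point of a level curve -/

/-- The open Euclidean disk. -/
def euclidDisk (p : ℝ × ℝ) (R : ℝ) : Set (ℝ × ℝ) :=
  {x | (x.1 - p.1) ^ 2 + (x.2 - p.2) ^ 2 < R ^ 2}

/-- The metric of the product is the sup metric, whose balls contain the Euclidean disks of the same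
radius. -/
theorem exists_euclidDisk_subset {p : ℝ × ℝ} {q : ℝ × ℝ → Prop} (h : ∀ᶠ x in 𝓝 p, q x) :
    ∃ R : ℝ, 0 < R ∧ ∀ x ∈ euclidDisk p R, q x := by
  obtain ⟨R, hR, H⟩ := Metric.eventually_nhds_iff.1 h
  refine ⟨R, hR, fun x hx => H ?_⟩
  have hx' : (x.1 - p.1) ^ 2 + (x.2 - p.2) ^ 2 < R ^ 2 := hx
  rw [Prod.dist_eq, Real.dist_eq, Real.dist_eq, max_lt_iff]
  constructor
  · exact abs_lt_of_sq_lt_sq (by nlinarith [sq_nonneg (x.2 - p.2)]) hR.le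
  · exact abs_lt_of_sq_lt_sq (by nlinarith [sq_nonneg (x.1 - p.1)]) hR.le

theorem circlePoint_sub_sq (p : ℝ × ℝ) (r t : ℝ) :
    ((circlePoint p r t).1 - p.1) ^ 2 + ((circlePoint p r t).2 - p.2) ^ 2 = r ^ 2 := by
  simp only [circlePoint]
  linear_combination r ^ 2 * Real.sin_sq_add_cos_sq t

theorem circlePoint_mem_euclidDisk (p : ℝ × ℝ) {r R : ℝ} (hr : 0 ≤ r) (hrR : r < R) (t : ℝ) :
    circlePoint p r t ∈ euclidDisk p R := by
  simp only [euclidDisk, mem_ofPred_eq]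
  rw [circlePoint_sub_sq]
  exact pow_lt_pow_left₀ hrR hr two_ne_zero

theorem circlePoint_ne {p : ℝ × ℝ} {r : ℝ} (hr : 0 < r) (t : ℝ) : circlePoint p r t ≠ p := by
  intro h
  have := circlePoint_sub_sq p r t
  rw [h] at this
  have := pow_pos hr 2
  simp at *
  linarith

theorem circlePoint_add_two_pi (p : ℝ × ℝ) (r t : ℝ) :
    circlePoint p r (t + 2 * Real.pi) = circlePoint p r t := by
  simp [circlePoint]

theorem continuous_circlePoint (p : ℝ × ℝ) (r : ℝ) : Continuous (circlePoint p r) := by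
  unfold circlePoint
  fun_prop

theorem cos_sin_eq_frame (φ t : ℝ) : ((Real.cos t, Real.sin t) : ℝ × ℝ)
    = (Real.cos (t - φ) * Real.cos φ - Real.sin (t - φ) * Real.sin φ,
      Real.cos (t - φ) * Real.sin φ + Real.sin (t - φ) * Real.cos φ) := by
  have h1 := Real.cos_add (t - φ) φ
  have h2 := Real.sin_add (t - φ) φ
  rw [sub_add_cancel] at h1 h2
  rw [h1, h2]
  exact Prod.ext rfl (add_comm _ _)

theorem neg_sin_cos_eq_frame (φ t : ℝ) : ((-Real.sin t, Real.cos t) : ℝ × ℝ)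
    = (-Real.sin (t - φ) * Real.cos φ - Real.cos (t - φ) * Real.sin φ,
      -Real.sin (t - φ) * Real.sin φ + Real.cos (t - φ) * Real.cos φ) := by
  have h1 := Real.cos_add (t - φ) φ
  have h2 := Real.sin_add (t - φ) φ
  rw [sub_add_cancel] at h1 h2
  rw [h1, h2]
  apply Prod.ext <;> simp only <;> ring

/-- Two vectors, one strictly within π/4 of the vertical and the other at most π/4 from it, have a
positive scalar product. -/
theorem cone_pos {h k c s : ℝ} (hk : |h| < k) (hcs : |c| ≤ s) (h1 : s ^ 2 + c ^ 2 = 1) :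
    0 < c * h + s * k := by
  have hs : 0 < s := by
    rcases ((abs_nonneg c).trans hcs).eq_or_lt with h0 | h0
    · rw [← h0] at hcs h1
      have := abs_nonpos_iff.1 hcs
      rw [this] at h1
      norm_num at h1
    · exact h0
  have e1 : |c * h| ≤ s * |h| := by
    rw [abs_mul]
    exact mul_le_mul_of_nonneg_right hcs (abs_nonneg h)
  have e2 := mul_lt_mul_of_pos_left hk hs
  have e3 := neg_abs_le (c * h)
  linarith

theorem abs_sin_le_cos {t : ℝ} (h : |t| ≤ Real.pi / 4) : |Real.sin t| ≤ Real.cos t := by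
  have hpi := Real.pi_pos
  have h' := abs_le.1 h
  have h0 := abs_nonneg t
  rw [← Real.cos_abs t, abs_le]
  constructor
  · have := Real.cos_le_cos_of_nonneg_of_le_pi (x := |t|) (y := Real.pi / 2 + t) h0
      (by linarith) (by linarith)
    rw [add_comm, Real.cos_add_pi_div_two] at this
    linarith
  · have := Real.cos_le_cos_of_nonneg_of_le_pi (x := |t|) (y := Real.pi / 2 - t) h0
      (by linarith) (by linarith)
    rwa [Real.cos_pi_div_two_sub] at this

/-- On the disk of radius `R` the gradient of `G` makes an angle less than `π / 4` with the
direction of angle `φ + π / 2`, and `G` vanishes at the centre. -/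
structure IsConeDisk (G : ℝ × ℝ → ℝ) (p : ℝ × ℝ) (φ R : ℝ) : Prop where
  zero : G p = 0
  diff : ∀ x ∈ euclidDisk p R, DifferentiableAt ℝ G x
  cone : ∀ x ∈ euclidDisk p R, |along φ x G| < across φ x G
  contAlong : ContinuousOn (fun x => along φ x G) (euclidDisk p R)
  contAcross : ContinuousOn (fun x => across φ x G) (euclidDisk p R)

namespace IsConeDisk

variable {G : ℝ × ℝ → ℝ} {p : ℝ × ℝ} {φ R r : ℝ}

theorem across_pos (hG : IsConeDisk G p φ R) {x : ℝ × ℝ} (hx : x ∈ euclidDisk p R) :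
    0 < across φ x G :=
  (abs_nonneg _).trans_lt (hG.cone x hx)

theorem hasDerivAt_radius (hG : IsConeDisk G p φ R) (t : ℝ) (hr : 0 ≤ r) (hrR : r < R) :
    HasDerivAt (fun s => G (circlePoint p s t))
      (Real.cos (t - φ) * along φ (circlePoint p r t) G
        + Real.sin (t - φ) * across φ (circlePoint p r t) G) r := by
  have h1 : HasDerivAt (fun s => circlePoint p s t) (Real.cos t, Real.sin t) r := by
    have h2 := ((hasDerivAt_id r).mul_const (Real.cos t)).const_add p.1
    have h3 := ((hasDerivAt_id r).mul_const (Real.sin t)).const_add p.2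
    simpa [circlePoint] using h2.prodMk h3
  have h4 := (hG.diff _ (circlePoint_mem_euclidDisk p hr hrR t)).hasFDerivAt.comp_hasDerivAt r h1
  rwa [cos_sin_eq_frame φ, fderiv_frame] at h4

theorem hasDerivAt_angle (hG : IsConeDisk G p φ R) (t : ℝ) (hr : 0 ≤ r) (hrR : r < R) :
    HasDerivAt (fun s => G (circlePoint p r s))
      (r * (-Real.sin (t - φ) * along φ (circlePoint p r t) G
        + Real.cos (t - φ) * across φ (circlePoint p r t) G)) t := by
  have h1 : HasDerivAt (fun s => circlePoint p r s) (r • (-Real.sin t, Real.cos t)) t := by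
    have h2 := ((Real.hasDerivAt_cos t).const_mul r).const_add p.1
    have h3 := ((Real.hasDerivAt_sin t).const_mul r).const_add p.2
    simpa [circlePoint] using h2.prodMk h3
  have h4 := (hG.diff _ (circlePoint_mem_euclidDisk p hr hrR t)).hasFDerivAt.comp_hasDerivAt t h1
  rwa [map_smul, neg_sin_cos_eq_frame φ, fderiv_frame] at h4

/-- Along a radius of the upper sector `G` increases strictly from its value 0 at the centre. -/
theorem pos_of_abs_cos_le (hG : IsConeDisk G p φ R) (hr : 0 < r) (hrR : r < R) {t : ℝ}
    (ht : |Real.cos (t - φ)| ≤ Real.sin (t - φ)) : 0 < G (circlePoint p r t) := by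
  have hd : ∀ s ∈ Icc 0 r, HasDerivAt (fun s => G (circlePoint p s t)) _ s := fun s hs =>
    hG.hasDerivAt_radius t hs.1 (hs.2.trans_lt hrR)
  have hm : StrictMonoOn (fun s => G (circlePoint p s t)) (Icc 0 r) := by
    refine strictMonoOn_of_deriv_pos (convex_Icc 0 r)
      (fun s hs => (hd s hs).continuousAt.continuousWithinAt) fun s hs => ?_
    rw [interior_Icc] at hs
    rw [(hd s (Ioo_subset_Icc_self hs)).deriv]
    exact cone_pos (hG.cone _ (circlePoint_mem_euclidDisk p hs.1.le (hs.2.trans hrR) t)) ht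
      (Real.sin_sq_add_cos_sq _)
  have := hm (left_mem_Icc.2 hr.le) (right_mem_Icc.2 hr.le) hr
  simpa [circlePoint, hG.zero] using this

theorem neg_of_abs_cos_le (hG : IsConeDisk G p φ R) (hr : 0 < r) (hrR : r < R) {t : ℝ}
    (ht : |Real.cos (t - φ)| ≤ -Real.sin (t - φ)) : G (circlePoint p r t) < 0 := by
  have hd : ∀ s ∈ Icc 0 r, HasDerivAt (fun s => G (circlePoint p s t)) _ s := fun s hs =>
    hG.hasDerivAt_radius t hs.1 (hs.2.trans_lt hrR)
  have hm : StrictAntiOn (fun s => G (circlePoint p s t)) (Icc 0 r) := by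
    refine strictAntiOn_of_deriv_neg (convex_Icc 0 r)
      (fun s hs => (hd s hs).continuousAt.continuousWithinAt) fun s hs => ?_
    rw [interior_Icc] at hs
    rw [(hd s (Ioo_subset_Icc_self hs)).deriv]
    have := cone_pos (c := -Real.cos (t - φ)) (s := -Real.sin (t - φ))
      (hG.cone _ (circlePoint_mem_euclidDisk p hs.1.le (hs.2.trans hrR) t)) (by rwa [abs_neg])
      (by rw [neg_sq, neg_sq]; exact Real.sin_sq_add_cos_sq _)
    linarith
  have := hm (left_mem_Icc.2 hr.le) (right_mem_Icc.2 hr.le) hr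
  simpa [circlePoint, hG.zero] using this

theorem deriv_pos_of_abs_sin_le (hG : IsConeDisk G p φ R) (hr : 0 < r) (hrR : r < R) {t : ℝ}
    (ht : |Real.sin (t - φ)| ≤ Real.cos (t - φ)) :
    0 < deriv (fun s => G (circlePoint p r s)) t := by
  rw [(hG.hasDerivAt_angle t hr.le hrR).deriv]
  exact mul_pos hr (cone_pos (hG.cone _ (circlePoint_mem_euclidDisk p hr.le hrR t))
    (by rwa [abs_neg]) (by rw [neg_sq, add_comm]; exact Real.sin_sq_add_cos_sq _))

theorem deriv_neg_of_abs_sin_le (hG : IsConeDisk G p φ R) (hr : 0 < r) (hrR : r < R) {t : ℝ}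
    (ht : |Real.sin (t - φ)| ≤ -Real.cos (t - φ)) :
    deriv (fun s => G (circlePoint p r s)) t < 0 := by
  rw [(hG.hasDerivAt_angle t hr.le hrR).deriv]
  refine mul_neg_of_pos_of_neg hr ?_
  have := cone_pos (c := Real.sin (t - φ)) (s := -Real.cos (t - φ))
    (hG.cone _ (circlePoint_mem_euclidDisk p hr.le hrR t))
    ht (by rw [neg_sq, add_comm]; exact Real.sin_sq_add_cos_sq _)
  linarith

theorem continuous_comp_circlePoint (hG : IsConeDisk G p φ R) (hr : 0 ≤ r) (hrR : r < R) :
    Continuous fun s => G (circlePoint p r s) :=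
  continuous_iff_continuousAt.2 fun t => (hG.hasDerivAt_angle t hr hrR).continuousAt

/-- The circle splits into four sectors of opening π/2 about the frame directions. `G` is positive
on the upper one, negative on the lower one and strictly monotone on the lateral ones, so it has one
zero on each lateral sector. -/
theorem exists_isBorderArc (hG : IsConeDisk G p φ R) (hr : 0 < r) (hrR : r < R) :
    ∃ a b, IsBorderArc G p r a b := by
  have hpi := Real.pi_pos
  set g : ℝ → ℝ := fun s => G (circlePoint p r s) with hg
  have hc : Continuous g := hG.continuous_comp_circlePoint hr.le hrR
  have top : ∀ t ∈ Icc (φ + Real.pi / 4) (φ + 3 * Real.pi / 4), 0 < g t := by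
    intro t ht
    apply hG.pos_of_abs_cos_le hr hrR
    have := abs_sin_le_cos (t := t - φ - Real.pi / 2)
      (abs_le.2 ⟨by linarith [ht.1], by linarith [ht.2]⟩)
    rwa [Real.sin_sub_pi_div_two, Real.cos_sub_pi_div_two, abs_neg] at this
  have bot : ∀ t ∈ Icc (φ + 5 * Real.pi / 4) (φ + 7 * Real.pi / 4), g t < 0 := by
    intro t ht
    apply hG.neg_of_abs_cos_le hr hrR
    have := abs_sin_le_cos (t := t - φ - Real.pi - Real.pi / 2)
      (abs_le.2 ⟨by linarith [ht.1], by linarith [ht.2]⟩)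
    rwa [Real.sin_sub_pi_div_two, Real.cos_sub_pi_div_two, abs_neg, Real.sin_sub_pi,
      Real.cos_sub_pi, abs_neg] at this
  have per : ∀ t, g (t + 2 * Real.pi) = g t := fun t => by
    simp only [hg, circlePoint_add_two_pi]
  have right : StrictMonoOn g (Icc (φ - Real.pi / 4) (φ + Real.pi / 4)) := by
    refine strictMonoOn_of_deriv_pos (convex_Icc _ _) hc.continuousOn fun t ht => ?_
    have ht := interior_subset ht
    exact hG.deriv_pos_of_abs_sin_le hr hrR
      (abs_sin_le_cos (abs_le.2 ⟨by linarith [ht.1], by linarith [ht.2]⟩))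
  have left : StrictAntiOn g (Icc (φ + 3 * Real.pi / 4) (φ + 5 * Real.pi / 4)) := by
    refine strictAntiOn_of_deriv_neg (convex_Icc _ _) hc.continuousOn fun t ht => ?_
    have ht := interior_subset ht
    apply hG.deriv_neg_of_abs_sin_le hr hrR
    have := abs_sin_le_cos (t := t - φ - Real.pi)
      (abs_le.2 ⟨by linarith [ht.1], by linarith [ht.2]⟩)
    rwa [Real.sin_sub_pi, Real.cos_sub_pi, abs_neg] at this
  have g1 : g (φ - Real.pi / 4) < 0 := by
    rw [← per]
    exact bot _ ⟨by linarith, by linarith⟩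
  have g2 : 0 < g (φ + Real.pi / 4) := top _ ⟨le_rfl, by linarith⟩
  have g3 : 0 < g (φ + 3 * Real.pi / 4) := top _ ⟨by linarith, le_rfl⟩
  have g4 : g (φ + 5 * Real.pi / 4) < 0 := bot _ ⟨le_rfl, by linarith⟩
  obtain ⟨a, ha, ga⟩ := intermediate_value_Icc (by linarith) hc.continuousOn
    (show (0 : ℝ) ∈ Icc (g (φ - Real.pi / 4)) (g (φ + Real.pi / 4)) from ⟨g1.le, g2.le⟩)
  obtain ⟨b, hb, gb⟩ := intermediate_value_Icc' (by linarith) hc.continuousOn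
    (show (0 : ℝ) ∈ Icc (g (φ + 5 * Real.pi / 4)) (g (φ + 3 * Real.pi / 4)) from ⟨g4.le, g3.le⟩)
  have ha1 : a ≠ φ - Real.pi / 4 := by rintro rfl; exact g1.ne ga
  have hb2 : b ≠ φ + 5 * Real.pi / 4 := by rintro rfl; exact g4.ne gb
  have ha1' := lt_of_le_of_ne ha.1 ha1.symm
  have hb2' := lt_of_le_of_ne hb.2 hb2
  refine ⟨a, b, by linarith [ha.2, hb.1], by linarith, ga, gb, fun t ht => ?_, fun t ht => ?_⟩
  · change 0 < g t
    rcases le_total t (φ + Real.pi / 4) with h1 | h1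
    · rw [← ga]
      exact right ha ⟨by linarith [ht.1], h1⟩ ht.1
    rcases le_total t (φ + 3 * Real.pi / 4) with h2 | h2
    · exact top t ⟨h1, h2⟩
    · rw [← gb]
      exact left ⟨h2, by linarith [ht.2]⟩ hb ht.2
  · change g t < 0
    rcases le_total t (φ + 5 * Real.pi / 4) with h1 | h1
    · rw [← gb]
      exact left hb ⟨by linarith [ht.1, hb.1], h1⟩ ht.1
    rcases le_total t (φ + 7 * Real.pi / 4) with h2 | h2
    · exact bot t ⟨h1, h2⟩
    · have := right (a := t - 2 * Real.pi) ⟨by linarith, by linarith [ht.2, ha.2]⟩ ha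
        (by linarith [ht.2])
      rwa [ga, ← per, sub_add_cancel] at this

theorem abs_sin_lt_abs_cos (hG : IsConeDisk G p φ R) (hr : 0 < r) (hrR : r < R) {t : ℝ}
    (ht : G (circlePoint p r t) = 0) : |Real.sin (t - φ)| < |Real.cos (t - φ)| := by
  by_contra hc
  rcases abs_cases (Real.sin (t - φ)) with h | h
  · exact (hG.pos_of_abs_cos_le hr hrR (h.1 ▸ not_lt.1 hc)).ne' ht
  · exact (hG.neg_of_abs_cos_le hr hrR (h.1 ▸ not_lt.1 hc)).ne ht

/-- A zero lies in a lateral sector. In the left one `G` decreases with the angle, whereas it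
becomes positive just after `a`; so A is on the right. -/
theorem cos_start_pos (hG : IsConeDisk G p φ R) (hr : 0 < r) (hrR : r < R) {a b : ℝ}
    (h : IsBorderArc G p r a b) : |Real.sin (a - φ)| < Real.cos (a - φ) := by
  have h1 := hG.abs_sin_lt_abs_cos hr hrR h.start
  rcases abs_cases (Real.cos (a - φ)) with h2 | h2
  · rwa [h2.1] at h1
  · exfalso
    rw [h2.1] at h1
    have h3 := hG.deriv_neg_of_abs_sin_le hr hrR h1.le
    have h4 := eventually_nhdsWithin_sign_eq_of_deriv_neg h3 h.start
    obtain ⟨t, ht1, ht2⟩ := ((h4.filter_mono nhdsWithin_le_nhds).and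
      (Ioo_mem_nhdsGT h.lt)).exists
    rw [sign_pos (h.inside t ht2), sign_neg (by linarith [ht2.1])] at ht1
    exact absurd ht1 (by decide)

theorem cos_finish_neg (hG : IsConeDisk G p φ R) (hr : 0 < r) (hrR : r < R) {a b : ℝ}
    (h : IsBorderArc G p r a b) : |Real.sin (b - φ)| < -Real.cos (b - φ) := by
  have h1 := hG.abs_sin_lt_abs_cos hr hrR h.finish
  rcases abs_cases (Real.cos (b - φ)) with h2 | h2
  · exfalso
    rw [h2.1] at h1
    have h3 := hG.deriv_pos_of_abs_sin_le hr hrR h1.le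
    have h4 := eventually_nhdsWithin_sign_eq_of_deriv_pos h3 h.finish
    obtain ⟨t, ht1, ht2⟩ := ((h4.filter_mono nhdsWithin_le_nhds).and
      (Ioo_mem_nhdsGT h.lt_add)).exists
    rw [sign_neg (h.outside t ht2), sign_pos (by linarith [ht2.1])] at ht1
    exact absurd ht1 (by decide)
  · rwa [h2.1] at h1

/-- The angle of the level curves that is close to `φ`. -/
def levelAngle (G : ℝ × ℝ → ℝ) (φ : ℝ) (x : ℝ × ℝ) : ℝ :=
  φ + Real.arctan (-(along φ x G / across φ x G))

theorem continuousOn_levelAngle (hG : IsConeDisk G p φ R) :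
    ContinuousOn (levelAngle G φ) (euclidDisk p R) :=
  continuousOn_const.add (Real.continuous_arctan.comp_continuousOn
    (hG.contAlong.div hG.contAcross fun _ hx => (hG.across_pos hx).ne').neg)

theorem closed_subset (p : ℝ × ℝ) (hr : 0 ≤ r) (hrR : r < R) :
    {x : ℝ × ℝ | (x.1 - p.1) ^ 2 + (x.2 - p.2) ^ 2 ≤ r ^ 2} ⊆ euclidDisk p R := fun x hx =>
  lt_of_le_of_lt (show (x.1 - p.1) ^ 2 + (x.2 - p.2) ^ 2 ≤ r ^ 2 from hx)
    (pow_lt_pow_left₀ hrR hr two_ne_zero)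

theorem isBoundaryAngle_levelAngle (hG : IsConeDisk G p φ R) (hr : 0 < r) (hrR : r < R) :
    IsBoundaryAngle G p r (levelAngle G φ) := by
  refine ⟨hG.continuousOn_levelAngle.mono (closed_subset p hr.le hrR), fun x hx => ?_⟩
  have hpos := hG.across_pos (closed_subset p hr.le hrR hx)
  set T := Real.arctan (-(along φ x G / across φ x G)) with hT
  have hcT : 0 < Real.cos T := Real.cos_arctan_pos _
  have hsT : Real.sin T * across φ x G = -along φ x G * Real.cos T := by
    have h1 : Real.tan T = -(along φ x G / across φ x G) := Real.tan_arctan _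
    rw [Real.tan_eq_sin_div_cos, div_eq_iff hcT.ne'] at h1
    rw [h1]
    field_simp
  have h := Real.sin_sq_add_cos_sq φ
  refine ⟨across φ x G / Real.cos T, div_pos hpos hcT, ?_, ?_⟩
  · rw [levelAngle, ← hT, Real.sin_add, div_mul_eq_mul_div, eq_div_iff hcT.ne']
    have : across φ x G * -(Real.sin φ * Real.cos T + Real.cos φ * Real.sin T)
        = (along φ x G * Real.cos φ - across φ x G * Real.sin φ) * Real.cos T := by
      linear_combination (-Real.cos φ) * hsT
    rw [this]
    congr 1
    simp only [along, across]
    linear_combination (-fderiv ℝ G x (1, 0)) * h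
  · rw [levelAngle, ← hT, Real.cos_add, div_mul_eq_mul_div, eq_div_iff hcT.ne']
    have : across φ x G * (Real.cos φ * Real.cos T - Real.sin φ * Real.sin T)
        = (along φ x G * Real.sin φ + across φ x G * Real.cos φ) * Real.cos T := by
      linear_combination (-Real.sin φ) * hsT
    rw [this]
    congr 1
    simp only [along, across]
    linear_combination (-fderiv ℝ G x (0, 1)) * h

/-- Any continuous angle of the level curves differs from `levelAngle` by a constant. -/
theorem exists_eq_levelAngle (hG : IsConeDisk G p φ R) (hr : 0 < r) (hrR : r < R)
    {β : ℝ × ℝ → ℝ} (hβ : IsBoundaryAngle G p r β) : ∃ N : ℤ, ∀ t,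
      β (circlePoint p r t) = levelAngle G φ (circlePoint p r t) + N * Real.pi := by
  set S : Set (ℝ × ℝ) := {x | (x.1 - p.1) ^ 2 + (x.2 - p.2) ^ 2 ≤ r ^ 2} with hS
  have hmem : ∀ t, circlePoint p r t ∈ S := fun t => (circlePoint_sub_sq p r t).le
  have hconv : Convex ℝ S := by
    have h1 : ConvexOn ℝ univ fun x : ℝ × ℝ => (x.1 - p.1) ^ 2 + (x.2 - p.2) ^ 2 := by
      refine ⟨convex_univ, fun x _ y _ s t hs ht hst => ?_⟩
      simp only [Prod.fst_add, Prod.snd_add, Prod.smul_fst, Prod.smul_snd, smul_eq_mul]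
      obtain rfl : t = 1 - s := by linarith
      nlinarith [mul_nonneg (mul_nonneg hs ht) (sq_nonneg (x.1 - y.1)),
        mul_nonneg (mul_nonneg hs ht) (sq_nonneg (x.2 - y.2))]
    simpa using h1.convex_le (r ^ 2)
  have hint : ∀ x ∈ S, ∃ n : ℤ, (β x - levelAngle G φ x) / Real.pi = n := by
    intro x hx
    have hxR := closed_subset p hr.le hrR hx
    obtain ⟨c, hc, e1, e2⟩ := hβ.angle x hx
    have hpos := hG.across_pos hxR
    set T := Real.arctan (-(along φ x G / across φ x G)) with hT
    have hcT : 0 < Real.cos T := Real.cos_arctan_pos _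
    have hsT : Real.sin T * across φ x G = -along φ x G * Real.cos T := by
      have h1 : Real.tan T = -(along φ x G / across φ x G) := Real.tan_arctan _
      rw [Real.tan_eq_sin_div_cos, div_eq_iff hcT.ne'] at h1
      rw [h1]
      field_simp
    have h1 : along φ x G = -c * Real.sin (β x - φ) := by
      rw [along, e1, e2, Real.sin_sub]
      ring
    have h2 : across φ x G = c * Real.cos (β x - φ) := by
      rw [across, e1, e2, Real.cos_sub]
      ring
    have hsin : Real.sin (β x - levelAngle G φ x) = 0 := by
      have h3 : β x - levelAngle G φ x = β x - φ - T := by rw [levelAngle]; ring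
      have h4 : c * Real.sin (β x - φ - T) = 0 := by
        rw [Real.sin_sub]
        rw [h1, h2] at hsT
        linarith
      rw [h3]
      exact (mul_eq_zero.1 h4).resolve_left hc.ne'
    obtain ⟨n, hn⟩ := Real.sin_eq_zero_iff.1 hsin
    exact ⟨n, by rw [← hn, mul_div_cancel_right₀ _ Real.pi_ne_zero]⟩
  have hcont : ContinuousOn (fun x => (β x - levelAngle G φ x) / Real.pi) S :=
    (hβ.cont.sub (hG.continuousOn_levelAngle.mono (closed_subset p hr.le hrR))).div_const _
  -- A continuous function on a connected set with values in the integers is constant, so one `N`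
  -- serves the whole disk.
  have hconst : ∀ x ∈ S, ∀ y ∈ S, (β x - levelAngle G φ x) / Real.pi
      = (β y - levelAngle G φ y) / Real.pi := by
    intro x hx y hy
    have hsub : ((fun x => (β x - levelAngle G φ x) / Real.pi) '' S)
        ⊆ range (Int.cast : ℤ → ℝ) := by
      rintro _ ⟨z, hz, rfl⟩
      obtain ⟨n, hn⟩ := hint z hz
      exact ⟨n, hn.symm⟩
    exact (countable_range _).isTotallyDisconnected _ hsub (hconv.isPreconnected.image _ hcont)
      (mem_image_of_mem _ hx) (mem_image_of_mem _ hy)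
  obtain ⟨N, hN⟩ := hint _ (hmem 0)
  refine ⟨N, fun t => ?_⟩
  have h1 := hconst _ (hmem t) _ (hmem 0)
  rw [hN, div_eq_iff Real.pi_ne_zero] at h1
  linarith

end IsConeDisk

/-! ### The zero lines of the fundamental cubic form near a godron -/

theorem cubicRoots_factor_homogeneous {a b c : ℝ} (hP : 0 < c ^ 2 - b)
    (hD : (a - 3 * b * c + 2 * c ^ 3) ^ 2 ≤ 4 * (c ^ 2 - b) ^ 3) (s t : ℝ) :
    a * s ^ 3 + 3 * b * s ^ 2 * t + 3 * c * s * t ^ 2 + t ^ 3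
      = (t - cubicRoots a b c 0 * s) * (t - cubicRoots a b c 1 * s)
        * (t - cubicRoots a b c 2 * s) := by
  have h0 := cubicRoots_factor hP hD 0
  have h1 := cubicRoots_factor hP hD 1
  have h2 := cubicRoots_factor hP hD (-1)
  -- The values at 0, 1, -1 recover the coefficients, hence the homogeneous identity, also for `s =
  -- 0`.
  linear_combination s ^ 3 * h0 + t ^ 2 * s * ((h1 + h2 - 2 * h0) / 2)
    + t * s ^ 2 * ((h1 - h2) / 2)

theorem cubicForm_smul (f : ℝ × ℝ → ℝ) (x v : ℝ × ℝ) (c : ℝ) :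
    cubicForm f x (c • v) = c ^ 3 * cubicForm f x v := by
  simp only [cubicForm, cubicPart, secondForm, map_smul, Prod.smul_fst, Prod.smul_snd,
    smul_eq_mul]
  ring

theorem lineOfAngle_mem_zeroLines (f : ℝ × ℝ → ℝ) (x : ℝ × ℝ) (t : ℝ) :
    lineOfAngle t ∈ zeroLines f x ↔ cubicForm f x (Real.cos t, Real.sin t) = 0 := by
  simp only [zeroLines, lineOfAngle, mem_ofPred_eq, Projectivization.submodule_mk]
  constructor
  · exact fun h => h _ (Submodule.mem_span_singleton_self _)
  · intro h v hv
    obtain ⟨c, rfl⟩ := Submodule.mem_span_singleton.1 hv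
    rw [cubicForm_smul, h, mul_zero]

/-- The slopes, in the frame of angle `φ`, of the zero lines of the fundamental cubic form. -/
def zeroSlope (f : ℝ × ℝ → ℝ) (φ : ℝ) (k : Fin 3) (x : ℝ × ℝ) : ℝ :=
  cubicRoots (coefA f φ x / coefD f φ x) (coefB f φ x / coefD f φ x)
    (coefC f φ x / coefD f φ x) k

/-- The angles of the zero lines of the fundamental cubic form. -/
def zeroAngle (f : ℝ × ℝ → ℝ) (φ : ℝ) (k : Fin 3) (x : ℝ × ℝ) : ℝ :=
  φ + Real.arctan (zeroSlope f φ k x)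

/-- The slope of the asymptotic line minus the slope of the parabolic curve, at a parabolic
point. -/
def slopeGap (f : ℝ × ℝ → ℝ) (φ : ℝ) (x : ℝ × ℝ) : ℝ :=
  along φ x (hessian f) / across φ x (hessian f) - quadF f φ x / quadG f φ x

/-- A disk around a godron on which the frame of angle `φ` is adapted to all the forms. -/
structure IsGodronDisk (f : ℝ × ℝ → ℝ) (p : ℝ × ℝ) (φ R : ℝ) : Prop
    extends IsConeDisk (hessian f) p φ R where
  apolar₁ : ∀ x ∈ euclidDisk p R,
    quadG f φ x * coefA f φ x - 2 * quadF f φ x * coefB f φ x + quadE f φ x * coefC f φ x = 0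
  apolar₂ : ∀ x ∈ euclidDisk p R,
    quadG f φ x * coefB f φ x - 2 * quadF f φ x * coefC f φ x + quadE f φ x * coefD f φ x = 0
  quadG_ne : ∀ x ∈ euclidDisk p R, quadG f φ x ≠ 0
  abs_quadF_le : ∀ x ∈ euclidDisk p R, |quadF f φ x| ≤ |quadG f φ x|
  coefD_ne : ∀ x ∈ euclidDisk p R, coefD f φ x ≠ 0
  contA : ContinuousOn (coefA f φ) (euclidDisk p R)
  contB : ContinuousOn (coefB f φ) (euclidDisk p R)
  contC : ContinuousOn (coefC f φ) (euclidDisk p R)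
  contD : ContinuousOn (coefD f φ) (euclidDisk p R)

/-! ### Existence of a disk adapted to a godron -/

section Existence

variable {U : Set (ℝ × ℝ)} {f : ℝ × ℝ → ℝ} {p : ℝ × ℝ}

/-- The frame adapted to the forms at a godron. -/
theorem IsGodron.exists_frame (h : IsGodron f p) : ∃ φ : ℝ,
    along φ p (hessian f) = 0 ∧ 0 < across φ p (hessian f) ∧ quadF f φ p = 0 ∧
      quadG f φ p ≠ 0 := by
  obtain ⟨h0, ⟨v, hv⟩, ⟨w, hw⟩, ht⟩ := h
  set X := fderiv ℝ (hessian f) p (1, 0) with hX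
  set Y := fderiv ℝ (hessian f) p (0, 1) with hY
  -- The vector (Y, -X) is the gradient turned by -π/2. Its argument gives a frame in which dH
  -- vanishes on the first vector and is positive on the second.
  have hz : (⟨Y, -X⟩ : ℂ) ≠ 0 := by
    intro hz
    rw [Complex.ext_iff] at hz
    have h1 : Y = 0 := hz.1
    have h2 : -X = 0 := hz.2
    apply hw
    rw [fderiv_apply_eq, ← hX, ← hY, h1, neg_eq_zero.1 h2]
    ring
  set φ := Complex.arg ⟨Y, -X⟩ with hφ
  set κ := ‖(⟨Y, -X⟩ : ℂ)‖ with hκ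
  have hκ0 : 0 < κ := norm_pos_iff.2 hz
  have e1 : κ * Real.cos φ = Y := Complex.norm_mul_cos_arg _
  have e2 : κ * Real.sin φ = -X := Complex.norm_mul_sin_arg _
  have hsc := Real.sin_sq_add_cos_sq φ
  have ha : along φ p (hessian f) = 0 := by
    rw [along, ← hX, ← hY]
    linear_combination Real.cos φ * e2 - Real.sin φ * e1
  have hc : across φ p (hessian f) = κ := by
    rw [across, ← hX, ← hY]
    linear_combination -Real.sin φ * e2 - Real.cos φ * e1 + κ * hsc
  have hH := hessian_frame f φ p
  rw [h0] at hH
  -- The vector with frame coordinates (-F, E) is asymptotic, since Q takes there the value E(EG -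
  -- F²)/2 = 0. Tangency of the asymptotic direction then forces E = 0.
  have hE : quadE f φ p = 0 := by
    have h1 := ht _ ((secondForm_frame f φ p (-quadF f φ p) (quadE f φ p)).trans (by
      linear_combination (-quadE f φ p / 2) * hH))
    rw [fderiv_frame, ha, hc, mul_zero, zero_add] at h1
    exact (mul_eq_zero.1 h1).resolve_right hκ0.ne'
  have hF : quadF f φ p = 0 := by
    rw [hE, zero_mul] at hH
    exact pow_eq_zero_iff two_ne_zero |>.1 (by linarith)
  refine ⟨φ, ha, hc ▸ hκ0, hF, fun hG => hv ?_⟩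
  obtain ⟨s, t, rfl⟩ := _root_.exists_frame φ v
  rw [secondForm_frame, hE, hF, hG]
  ring

/-- The inequalities are open and hold at `p` in the adapted frame; in particular D = -G·`across`/2
≠ 0 there, because H vanishes. -/
theorem IsGodron.exists_isGodronDisk (hU : IsOpen U) (hf : ContDiffOn ℝ ∞ f U) (hp : p ∈ U)
    (h : IsGodron f p) {q : ℝ × ℝ → Prop} (hq : ∀ᶠ x in 𝓝[≠] p, q x) :
    ∃ φ R : ℝ, 0 < R ∧ IsGodronDisk f p φ R ∧ ∀ x ∈ euclidDisk p R, x ≠ p → q x := by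
  obtain ⟨φ, h1, h2, h3, h4⟩ := h.exists_frame
  have cpd : ∀ i j, ContinuousOn (pd i j f) U := fun i j => (contDiffOn_pd hU hf i j).continuousOn
  have cH : ContinuousOn (hessian f) U := (contDiffOn_hessian hU hf).continuousOn
  have cdH : ∀ v, ContinuousOn (fun x => fderiv ℝ (hessian f) x v) U := fun v =>
    (contDiffOn_fderiv_apply hU (contDiffOn_hessian hU hf) v).continuousOn
  have cal : ContinuousOn (fun x => along φ x (hessian f)) U :=
    ((cdH _).mul continuousOn_const).add ((cdH _).mul continuousOn_const)
  have cac : ContinuousOn (fun x => across φ x (hessian f)) U :=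
    ((cdH _).neg.mul continuousOn_const).add ((cdH _).mul continuousOn_const)
  have c20 := cpd 2 0
  have c11 := cpd 1 1
  have c02 := cpd 0 2
  have c30 := cpd 3 0
  have c21 := cpd 2 1
  have c12 := cpd 1 2
  have c03 := cpd 0 3
  have cE : ContinuousOn (quadE f φ) U := by unfold quadE; fun_prop
  have cF : ContinuousOn (quadF f φ) U := by unfold quadF; fun_prop
  have cG : ContinuousOn (quadG f φ) U := by unfold quadG; fun_prop
  have c0 : ContinuousOn (third₀ f φ) U := by unfold third₀; fun_prop
  have c1 : ContinuousOn (third₁ f φ) U := by unfold third₁; fun_prop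
  have c2 : ContinuousOn (third₂ f φ) U := by unfold third₂; fun_prop
  have c3 : ContinuousOn (third₃ f φ) U := by unfold third₃; fun_prop
  have cA : ContinuousOn (coefA f φ) U := by unfold coefA; fun_prop
  have cB : ContinuousOn (coefB f φ) U := by unfold coefB; fun_prop
  have cC : ContinuousOn (coefC f φ) U := by unfold coefC; fun_prop
  have cD : ContinuousOn (coefD f φ) U := by unfold coefD; fun_prop
  have hUp : U ∈ 𝓝 p := hU.mem_nhds hp
  have ev1 : ∀ᶠ x in 𝓝 p, |along φ x (hessian f)| < across φ x (hessian f) :=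
    (cal.continuousAt hUp).abs.eventually_lt (cac.continuousAt hUp) (by rwa [h1, abs_zero])
  have ev2 : ∀ᶠ x in 𝓝 p, |quadF f φ x| < |quadG f φ x| :=
    (cF.continuousAt hUp).abs.eventually_lt (cG.continuousAt hUp).abs
      (by rw [h3, abs_zero]; exact abs_pos.2 h4)
  have ev3 : ∀ᶠ x in 𝓝 p, coefD f φ x ≠ 0 := by
    refine (cD.continuousAt hUp).eventually_ne ?_
    rw [coefD, h.1]
    have := mul_ne_zero h4 h2.ne'
    intro h5
    apply this
    linarith
  have ev4 : ∀ᶠ x in 𝓝 p, x ≠ p → q x := eventually_nhdsWithin_iff.1 hq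
  obtain ⟨R, hR, H⟩ := exists_euclidDisk_subset
    ((eventually_mem_set.2 hUp).and (ev1.and (ev2.and (ev3.and ev4))))
  have hsub : euclidDisk p R ⊆ U := fun x hx => (H x hx).1
  exact ⟨φ, R, hR,
    { zero := h.1
      diff := fun x hx => ((contDiffOn_hessian hU hf).contDiffAt
        (hU.mem_nhds (hsub hx))).differentiableAt (by simp)
      cone := fun x hx => (H x hx).2.1
      contAlong := cal.mono hsub
      contAcross := cac.mono hsub
      apolar₁ := fun x hx => (apolar φ hU hf (hsub hx)).1
      apolar₂ := fun x hx => (apolar φ hU hf (hsub hx)).2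
      quadG_ne := fun x hx => abs_pos.1 ((abs_nonneg _).trans_lt (H x hx).2.2.1)
      abs_quadF_le := fun x hx => (H x hx).2.2.1.le
      coefD_ne := fun x hx => (H x hx).2.2.2.1
      contA := cA.mono hsub
      contB := cB.mono hsub
      contC := cC.mono hsub
      contD := cD.mono hsub },
    fun x hx => (H x hx).2.2.2.2⟩

end Existence

/-! ### Zero lines and index on an adapted disk -/

namespace IsGodronDisk

variable {f : ℝ × ℝ → ℝ} {p x : ℝ × ℝ} {φ R r a b : ℝ}

theorem discr (hg : IsGodronDisk f p φ R) (hx : x ∈ euclidDisk p R) :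
    (coefC f φ x / coefD f φ x) ^ 2 - coefB f φ x / coefD f φ x
      = (coefC f φ x / coefD f φ x - quadF f φ x / quadG f φ x) ^ 2
        + hessian f x / quadG f φ x ^ 2 ∧
    4 * ((coefC f φ x / coefD f φ x) ^ 2 - coefB f φ x / coefD f φ x) ^ 3
      - (coefA f φ x / coefD f φ x
        - 3 * (coefB f φ x / coefD f φ x) * (coefC f φ x / coefD f φ x)
        + 2 * (coefC f φ x / coefD f φ x) ^ 3) ^ 2
      = 4 * (hessian f x / quadG f φ x ^ 2)
        * ((coefC f φ x / coefD f φ x) ^ 2 - coefB f φ x / coefD f φ x) ^ 2 := by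
  rw [hessian_frame f φ x]
  exact discr_of_apolar (hg.quadG_ne x hx) (hg.coefD_ne x hx) (hg.apolar₁ x hx)
    (hg.apolar₂ x hx)

theorem discr_of_pos (hg : IsGodronDisk f p φ R) (hx : x ∈ euclidDisk p R)
    (hH : 0 < hessian f x) :
    0 < (coefC f φ x / coefD f φ x) ^ 2 - coefB f φ x / coefD f φ x ∧
    (coefA f φ x / coefD f φ x - 3 * (coefB f φ x / coefD f φ x) * (coefC f φ x / coefD f φ x)
        + 2 * (coefC f φ x / coefD f φ x) ^ 3) ^ 2
      < 4 * ((coefC f φ x / coefD f φ x) ^ 2 - coefB f φ x / coefD f φ x) ^ 3 := by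
  obtain ⟨h1, h2⟩ := hg.discr hx
  have hη : 0 < hessian f x / quadG f φ x ^ 2 :=
    div_pos hH (sq_pos_of_ne_zero (hg.quadG_ne x hx))
  have hP : 0 < (coefC f φ x / coefD f φ x) ^ 2 - coefB f φ x / coefD f φ x := by
    rw [h1]
    positivity
  refine ⟨hP, sub_pos.1 ?_⟩
  rw [h2]
  positivity

/-- Here P is the square of `slopeGap`/3, so transversality of the asymptotic line means that the
root is double and not triple. -/
theorem discr_of_zero (hg : IsGodronDisk f p φ R) (hx : x ∈ euclidDisk p R)
    (hH : hessian f x = 0) (hgap : slopeGap f φ x ≠ 0) :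
    0 < (coefC f φ x / coefD f φ x) ^ 2 - coefB f φ x / coefD f φ x ∧
    (coefA f φ x / coefD f φ x - 3 * (coefB f φ x / coefD f φ x) * (coefC f φ x / coefD f φ x)
        + 2 * (coefC f φ x / coefD f φ x) ^ 3) ^ 2
      ≤ 4 * ((coefC f φ x / coefD f φ x) ^ 2 - coefB f φ x / coefD f φ x) ^ 3 := by
  obtain ⟨h1, h2⟩ := hg.discr hx
  have h3 := (coef_of_hessian_eq_zero φ hH (hg.quadG_ne x hx) (hg.across_pos hx).ne' 0).1
  rw [← slopeGap] at h3
  constructor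
  · rw [h1, h3, hH]
    have := sq_pos_of_ne_zero hgap
    simp only [zero_div, add_zero]
    positivity
  · rw [← sub_nonneg, h2, hH]
    simp

/-- The sign of `slopeGap` tells on which side of the simple root, the slope of the parabolic curve,
the double asymptotic root lies. -/
theorem zeroAngle_of_zero (hg : IsGodronDisk f p φ R) (hx : x ∈ euclidDisk p R)
    (hH : hessian f x = 0) :
    (0 < slopeGap f φ x → zeroAngle f φ 0 x = IsConeDisk.levelAngle (hessian f) φ x ∧
      zeroAngle f φ 0 x < zeroAngle f φ 1 x) ∧
    (slopeGap f φ x < 0 → zeroAngle f φ 2 x = IsConeDisk.levelAngle (hessian f) φ x ∧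
      zeroAngle f φ 1 x < zeroAngle f φ 2 x) := by
  have key : slopeGap f φ x ≠ 0 → _ := fun hgap => by
    obtain ⟨hP, hD⟩ := hg.discr_of_zero hx hH hgap
    obtain ⟨o1, o2⟩ := cubicRoots_le (a := coefA f φ x / coefD f φ x) hP
    exact roots_of_double o1 o2
      (fun e => hgap (by rw [slopeGap]; linarith)) fun u => (cubicRoots_factor hP hD u).symm.trans
        (coef_of_hessian_eq_zero φ hH (hg.quadG_ne x hx) (hg.across_pos hx).ne' u).2
  unfold zeroAngle IsConeDisk.levelAngle zeroSlope
  constructor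
  · intro h
    obtain ⟨h1, h2, -⟩ := (key h.ne').2 (by rw [slopeGap] at h; linarith)
    rw [h1, h2]
    refine ⟨rfl, ?_⟩
    have := Real.arctan_strictMono (show -(along φ x (hessian f) / across φ x (hessian f))
      < -(quadF f φ x / quadG f φ x) by rw [slopeGap] at h; linarith)
    linarith
  · intro h
    obtain ⟨-, h1, h2⟩ := (key h.ne).1 (by rw [slopeGap] at h; linarith)
    rw [h1, h2]
    refine ⟨rfl, ?_⟩
    have := Real.arctan_strictMono (show -(quadF f φ x / quadG f φ x)
      < -(along φ x (hessian f) / across φ x (hessian f)) by rw [slopeGap] at h; linarith)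
    linarith

/-- Because D ≠ 0, the second vector of the frame is not a zero direction, so every zero line has a
slope. -/
theorem zeroLines_eq_range (hg : IsGodronDisk f p φ R) (hx : x ∈ euclidDisk p R)
    (hH : 0 < hessian f x) :
    zeroLines f x = range fun k => lineOfAngle (zeroAngle f φ k x) := by
  obtain ⟨hP, hD⟩ := hg.discr_of_pos hx hH
  ext l
  obtain ⟨t, rfl⟩ := exists_eq_lineOfAngle l
  have hW : cubicForm f x (Real.cos t, Real.sin t) = coefD f φ x *
      ((Real.sin (t - φ) - zeroSlope f φ 0 x * Real.cos (t - φ))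
        * (Real.sin (t - φ) - zeroSlope f φ 1 x * Real.cos (t - φ))
        * (Real.sin (t - φ) - zeroSlope f φ 2 x * Real.cos (t - φ))) := by
    rw [cos_sin_eq_frame φ, cubicForm_frame]
    unfold zeroSlope
    rw [← cubicRoots_factor_homogeneous hP hD.le]
    have := hg.coefD_ne x hx
    field_simp
  have hline : ∀ k, lineOfAngle (zeroAngle f φ k x) = lineOfAngle t ↔
      Real.sin (t - φ) - zeroSlope f φ k x * Real.cos (t - φ) = 0 := by
    intro k
    rw [eq_comm, lineOfAngle_eq_iff_sin, zeroAngle, ← sub_sub, Real.sin_sub]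
    set T := Real.arctan (zeroSlope f φ k x) with hT
    have hc : 0 < Real.cos T := Real.cos_arctan_pos _
    have hs : Real.sin T = zeroSlope f φ k x * Real.cos T := by
      have h1 : Real.tan T = zeroSlope f φ k x := Real.tan_arctan _
      rwa [Real.tan_eq_sin_div_cos, div_eq_iff hc.ne'] at h1
    have : Real.sin (t - φ) * Real.cos T - Real.cos (t - φ) * Real.sin T
        = (Real.sin (t - φ) - zeroSlope f φ k x * Real.cos (t - φ)) * Real.cos T := by
      rw [hs]
      ring
    rw [this, mul_eq_zero, or_iff_left hc.ne']
  rw [lineOfAngle_mem_zeroLines, hW, mul_eq_zero, or_iff_right (hg.coefD_ne x hx), mul_eq_zero,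
    mul_eq_zero, mem_range, Fin.exists_fin_succ, Fin.exists_fin_two]
  change _ ↔ lineOfAngle (zeroAngle f φ 0 x) = lineOfAngle t ∨
    lineOfAngle (zeroAngle f φ 1 x) = lineOfAngle t ∨
    lineOfAngle (zeroAngle f φ 2 x) = lineOfAngle t
  rw [hline, hline, hline, or_assoc]

/-- P is positive on the whole closed arc: inside because H > 0, at the ends because of the gaps.
The half-turn bound comes from the range of `arctan`. -/
theorem isOrdered_zeroAngle (hg : IsGodronDisk f p φ R) (hr : 0 < r) (hrR : r < R)
    (harc : IsBorderArc (hessian f) p r a b) (hA : slopeGap f φ (circlePoint p r a) ≠ 0)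
    (hB : slopeGap f φ (circlePoint p r b) ≠ 0) :
    IsOrdered a b fun k t => zeroAngle f φ k (circlePoint p r t) := by
  have hmem : ∀ t, circlePoint p r t ∈ euclidDisk p R :=
    circlePoint_mem_euclidDisk p hr.le hrR
  have hP : ∀ t ∈ Icc a b, 0 < (coefC f φ (circlePoint p r t) / coefD f φ (circlePoint p r t)) ^ 2
      - coefB f φ (circlePoint p r t) / coefD f φ (circlePoint p r t) := by
    intro t ht
    rcases ht.1.eq_or_lt with rfl | h1
    · exact (hg.discr_of_zero (hmem _) harc.start hA).1
    rcases ht.2.eq_or_lt with rfl | h2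
    · exact (hg.discr_of_zero (hmem _) harc.finish hB).1
    · exact (hg.discr_of_pos (hmem _) (harc.inside t ⟨h1, h2⟩)).1
  have hcomp : ∀ g : ℝ × ℝ → ℝ, ContinuousOn g (euclidDisk p R) →
      ContinuousOn (fun t => g (circlePoint p r t)) (Icc a b) := fun g hgc =>
    hgc.comp (continuous_circlePoint p r).continuousOn fun t _ => hmem t
  have hdiv : ∀ g : ℝ × ℝ → ℝ, ContinuousOn g (euclidDisk p R) →
      ContinuousOn (fun t => g (circlePoint p r t) / coefD f φ (circlePoint p r t)) (Icc a b) :=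
    fun g hgc => (hcomp g hgc).div (hcomp _ hg.contD) fun t _ => hg.coefD_ne _ (hmem t)
  refine ⟨fun k => ?_, fun t ht => ?_, fun t ht => ?_, fun t _ => ?_, fun t ht => ?_⟩
  · exact continuousOn_const.add (Real.continuous_arctan.comp_continuousOn
      (continuousOn_cubicRoots (hdiv _ hg.contA) (hdiv _ hg.contB) (hdiv _ hg.contC) hP k))
  · exact (add_le_add_iff_left φ).2 (Real.arctan_strictMono.monotone (cubicRoots_le (hP t ht)).1)
  · exact (add_le_add_iff_left φ).2 (Real.arctan_strictMono.monotone (cubicRoots_le (hP t ht)).2)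
  · have h1 := Real.arctan_lt_pi_div_two (zeroSlope f φ 2 (circlePoint p r t))
    have h2 := Real.neg_pi_div_two_lt_arctan (zeroSlope f φ 0 (circlePoint p r t))
    simp only [zeroAngle]
    linarith
  · obtain ⟨h1, h2⟩ := hg.discr_of_pos (hmem t) (harc.inside t ht)
    obtain ⟨h3, h4⟩ := cubicRoots_lt h1 h2
    refine ⟨(add_lt_add_iff_left φ).2 (Real.arctan_strictMono h3),
      (add_lt_add_iff_left φ).2 (Real.arctan_strictMono h4), ?_⟩
    have h1 := Real.arctan_lt_pi_div_two (zeroSlope f φ 2 (circlePoint p r t))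
    have h2 := Real.neg_pi_div_two_lt_arctan (zeroSlope f φ 0 (circlePoint p r t))
    simp only [zeroAngle]
    linarith

/-- The index of the field of zero lines, from the relative positions of the asymptotic line and
of the parabolic curve at the endpoints of the arcs. -/
theorem hasBorderIndex (hg : IsGodronDisk f p φ R) (hR : 0 < R) {m : ℤ}
    (hs : ∀ r a b : ℝ, 0 < r → r < R → IsBorderArc (hessian f) p r a b →
      (m = -1 ∧ 0 < slopeGap f φ (circlePoint p r a) ∧ slopeGap f φ (circlePoint p r b) < 0) ∨
      (m = 1 ∧ slopeGap f φ (circlePoint p r a) < 0 ∧ 0 < slopeGap f φ (circlePoint p r b))) :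
    HasBorderIndex 3 (hessian f) (zeroLines f) p (m / 3) := by
  refine ⟨R, hR, fun r hr hrR => ?_⟩
  have hmem : ∀ t, circlePoint p r t ∈ euclidDisk p R :=
    circlePoint_mem_euclidDisk p hr.le hrR
  have hord : ∀ a b, IsBorderArc (hessian f) p r a b →
      IsOrdered a b fun k t => zeroAngle f φ k (circlePoint p r t) := by
    intro a b harc
    rcases hs r a b hr hrR harc with ⟨-, h1, h2⟩ | ⟨-, h1, h2⟩
    · exact hg.isOrdered_zeroAngle hr hrR harc h1.ne' h2.ne
    · exact hg.isOrdered_zeroAngle hr hrR harc h1.ne h2.ne'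
  constructor
  · obtain ⟨a, b, harc⟩ := hg.exists_isBorderArc hr hrR
    have ho := hord a b harc
    exact ⟨a, b, _, _, harc, hg.isBoundaryAngle_levelAngle hr hrR,
      { cont := ho.cont
        distinct := fun t ht => (ho.sorted t ht).lineOfAngle_injective
        lines := fun t ht => hg.zeroLines_eq_range (hmem t) (harc.inside t ht) }⟩
  · rintro a b β θ ⟨harc, hβ, hθ⟩
    obtain ⟨N, hN⟩ := hg.exists_eq_levelAngle hr hrR hβ
    have hl : ∀ t ∈ Ioo a b, (range fun i => lineOfAngle (θ i t))
        = range fun k => lineOfAngle (zeroAngle f φ k (circlePoint p r t)) := fun t ht => by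
      rw [← hθ.lines t ht, hg.zeroLines_eq_range (hmem t) (harc.inside t ht)]
    obtain ⟨a1, a2⟩ := hg.zeroAngle_of_zero (hmem a) harc.start
    obtain ⟨b1, b2⟩ := hg.zeroAngle_of_zero (hmem b) harc.finish
    rcases hs r a b hr hrR harc with ⟨hm, h1, h2⟩ | ⟨hm, h1, h2⟩
    · exact (hord a b harc).index_of_branches harc.lt hθ.cont hθ.distinct hl (kA := 0) (kB := 2)
        (by rw [hN, (a1 h1).1]) (by rw [hN, (b2 h2).1])
        (Or.inl ⟨rfl, rfl, hm, (a1 h1).2, (b2 h2).2⟩)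
    · exact (hord a b harc).index_of_branches harc.lt hθ.cont hθ.distinct hl (kA := 2) (kB := 0)
        (by rw [hN, (a2 h1).1]) (by rw [hN, (b1 h2).1])
        (Or.inr ⟨rfl, rfl, hm, (a2 h1).2, (b1 h2).2⟩)

/-- The position of the asymptotic line at a parabolic point `x`, from the half of it, pointing
towards `p` (`σ = 1`) or away from `p` (`σ = -1`), that is directed to the hyperbolic domain. -/
theorem slopeGap_sign (hg : IsGodronDisk f p φ R) (hx : x ∈ euclidDisk p R) {σ : ℝ}
    (hH : hessian f x = 0)
    (hσ : ∀ v : ℝ × ℝ, v ≠ 0 → secondForm f x v = 0 → fderiv ℝ (hessian f) x v ≠ 0 ∧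
      (fderiv ℝ (hessian f) x v < 0 → 0 < σ * (v.1 * (p.1 - x.1) + v.2 * (p.2 - x.2))))
    {t : ℝ} (hr : 0 < r) (hxt : x = circlePoint p r t) :
    (|Real.sin (t - φ)| < Real.cos (t - φ) → 0 < σ * slopeGap f φ x) ∧
    (|Real.sin (t - φ)| < -Real.cos (t - φ) → σ * slopeGap f φ x < 0) := by
  obtain ⟨u, hu⟩ : ∃ u, u = -(quadF f φ x / quadG f φ x) := ⟨_, rfl⟩
  have hG := hg.quadG_ne x hx
  have hac := hg.across_pos hx
  -- With |u| ≤ 1 the quantity cos + u sin has the sign of cos on the lateral sectors. Hence the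
  -- asymptotic vector (1, u) points away from `p` on the right and towards it on the left.
  have hu1 : |u| ≤ 1 := by
    rw [hu, abs_neg, abs_div, div_le_one (abs_pos.2 hG)]
    exact hg.abs_quadF_le x hx
  have hsc := Real.sin_sq_add_cos_sq φ
  set v : ℝ × ℝ := (1 * Real.cos φ - u * Real.sin φ, 1 * Real.sin φ + u * Real.cos φ) with hv
  have hv0 : v ≠ 0 := by
    intro h
    have h1 : 1 * Real.cos φ - u * Real.sin φ = 0 := congrArg Prod.fst h
    have h2 : 1 * Real.sin φ + u * Real.cos φ = 0 := congrArg Prod.snd h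
    have : (1 : ℝ) = 0 := by linear_combination Real.cos φ * h1 + Real.sin φ * h2 - hsc
    exact one_ne_zero this
  have hQ : secondForm f x v = 0 := by
    rw [hessian_frame f φ x] at hH
    rw [hv, secondForm_frame, hu]
    field_simp
    linear_combination hH
  have hQ' : secondForm f x (-v) = 0 := by
    rw [← hQ]
    simp only [secondForm, Prod.fst_neg, Prod.snd_neg]
    ring
  have hdv : fderiv ℝ (hessian f) x v = across φ x (hessian f) * slopeGap f φ x := by
    rw [hv, fderiv_frame, slopeGap, hu]
    field_simp
    ring
  have hw : v.1 * (p.1 - x.1) + v.2 * (p.2 - x.2)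
      = -r * (Real.cos (t - φ) + u * Real.sin (t - φ)) := by
    rw [hxt, hv, Real.cos_sub, Real.sin_sub]
    simp only [circlePoint]
    ring
  have hb : |u * Real.sin (t - φ)| ≤ |Real.sin (t - φ)| := by
    rw [abs_mul]
    exact mul_le_of_le_one_left (abs_nonneg _) hu1
  have hb' := abs_le.1 hb
  obtain ⟨hne, h1⟩ := hσ v hv0 hQ
  obtain ⟨-, h2⟩ := hσ (-v) (neg_ne_zero.2 hv0) hQ'
  rw [map_neg, Prod.fst_neg, Prod.snd_neg] at h2
  rw [hdv] at h1 h2 hne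
  have h2' : 0 < slopeGap f φ x →
      0 < -σ * (v.1 * (p.1 - x.1) + v.2 * (p.2 - x.2)) := fun h => by
    have := h2 (neg_neg_of_pos (mul_pos hac h))
    linarith
  have h1' : slopeGap f φ x < 0 →
      0 < σ * (v.1 * (p.1 - x.1) + v.2 * (p.2 - x.2)) := fun h =>
    h1 (mul_neg_of_pos_of_neg hac h)
  have hgap : slopeGap f φ x ≠ 0 := right_ne_zero_of_mul hne
  rw [hw] at h1' h2'
  constructor
  · intro hcs
    have hw0 : 0 < r * (Real.cos (t - φ) + u * Real.sin (t - φ)) := mul_pos hr (by linarith)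
    rcases hgap.lt_or_gt with h | h
    · exact mul_pos_of_neg_of_neg (by nlinarith [h1' h]) h
    · exact mul_pos (by nlinarith [h2' h]) h
  · intro hcs
    have hw0 : r * (Real.cos (t - φ) + u * Real.sin (t - φ)) < 0 :=
      mul_neg_of_pos_of_neg hr (by linarith)
    rcases hgap.lt_or_gt with h | h
    · exact mul_neg_of_pos_of_neg (by nlinarith [h1' h]) h
    · exact mul_neg_of_neg_of_pos (by nlinarith [h2' h]) h

end IsGodronDisk

end

/-! ### The index of a positive and of a negative godron -/

theorem proposition4 (U : Set (ℝ × ℝ)) (hU : IsOpen U) (f : ℝ × ℝ → ℝ)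
    (hf : ContDiffOn ℝ ∞ f U) (p : ℝ × ℝ) (hp : p ∈ U) :
    (IsPositiveGodron f p → HasBorderIndex 3 (hessian f) (zeroLines f) p (-1 / 3)) ∧
    (IsNegativeGodron f p → HasBorderIndex 3 (hessian f) (zeroLines f) p (1 / 3)) := by
  constructor
  · rintro ⟨hgod, hev⟩
    obtain ⟨φ, R, hR, hg, H⟩ := hgod.exists_isGodronDisk hU hf hp hev
    have := hg.hasBorderIndex hR (m := -1) fun r a b hr hrR harc => by
      have hmem := circlePoint_mem_euclidDisk p hr.le hrR
      have hne := circlePoint_ne (p := p) hr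
      have h1 := (hg.slopeGap_sign (hmem a) (σ := 1) harc.start
        (by simpa using H _ (hmem a) (hne a) harc.start) hr rfl).1 (hg.cos_start_pos hr hrR harc)
      have h2 := (hg.slopeGap_sign (hmem b) (σ := 1) harc.finish
        (by simpa using H _ (hmem b) (hne b) harc.finish) hr rfl).2
        (hg.cos_finish_neg hr hrR harc)
      -- A is on the right and B on the left, so the same behaviour with respect to `p` gives gaps
      -- of opposite signs.
      exact Or.inl ⟨rfl, by linarith, by linarith⟩
    simpa using this
  · rintro ⟨hgod, hev⟩
    obtain ⟨φ, R, hR, hg, H⟩ := hgod.exists_isGodronDisk hU hf hp hev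
    have hσ : ∀ x : ℝ × ℝ, (∀ v : ℝ × ℝ, v ≠ 0 → secondForm f x v = 0 →
        fderiv ℝ (hessian f) x v ≠ 0 ∧ (fderiv ℝ (hessian f) x v < 0 →
          v.1 * (p.1 - x.1) + v.2 * (p.2 - x.2) < 0)) →
        ∀ v : ℝ × ℝ, v ≠ 0 → secondForm f x v = 0 →
        fderiv ℝ (hessian f) x v ≠ 0 ∧ (fderiv ℝ (hessian f) x v < 0 →
          0 < (-1 : ℝ) * (v.1 * (p.1 - x.1) + v.2 * (p.2 - x.2))) := fun x h v hv hQ =>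
      ⟨(h v hv hQ).1, fun hd => by linarith [(h v hv hQ).2 hd]⟩
    have := hg.hasBorderIndex hR (m := 1) fun r a b hr hrR harc => by
      have hmem := circlePoint_mem_euclidDisk p hr.le hrR
      have hne := circlePoint_ne (p := p) hr
      have h1 := (hg.slopeGap_sign (hmem a) (σ := -1) harc.start
        (hσ _ (H _ (hmem a) (hne a) harc.start)) hr rfl).1 (hg.cos_start_pos hr hrR harc)
      have h2 := (hg.slopeGap_sign (hmem b) (σ := -1) harc.finish
        (hσ _ (H _ (hmem b) (hne b) harc.finish)) hr rfl).2 (hg.cos_finish_neg hr hrR harc)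
      exact Or.inr ⟨rfl, by linarith, by linarith⟩
    simpa using this
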